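/- Let $k\ge 3$, $d\ge 3$ and $m\ge d+1$ be integers. For a tree $T$, its $k$-th power $T^k$ is the $k$-uniform hypergraph obtained from $T$ by adding, for each edge $e$ of $T$, $k-2$ new vertices to $e$ (distinct edges receiving disjoint sets of new vertices); a $k$-uniform hypertree is a hypergraph isomorphic to the $k$-th power of a finite tree. Let $\mathbb{H}(m,d,k)$ be the set of $k$-uniform hypertrees with $m$ edges and diameter $d$, where the diameter is the maximum distance between two vertices and the distance is the length (number of edges) of a shortest path. Let $S_1(m,d,k)$ be the $k$-uniform hypergraph obtained from a loose path $v_1,e_1,v_2,\ldots,v_d,e_d,v_{d+1}$ with $d$ edges (the $k$-th power of the ordinary path $v_1v_2\cdots v_{d+1}$) by attaching $m-d$ pendent edges at the vertex $v_{\lfloor d/2\rfloor+1}$ (each consisting of this vertex and $k-1$ new vertices). For a $k$-uniform hypergraph $G$ on $n$ vertices, let $\mathcal{Q}(G)=\mathcal{D}(G)+\mathcal{A}(G)$ be its signless Laplacian tensor: the sum of the order-$k$ diagonal tensor of the vertex degrees and of the adjacency tensor, whose entries are $a_{i_1\cdots i_k}=\frac{1}{(k-1)!}$ if $\{i_1,\ldots,i_k\}\in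 E(G)$ and $0$ otherwise. Let $q(G)$ be its spectral radius, i.e. the maximum of $|\lambda|$ over all $\lambda\in\mathbb{C}$ for which there is a nonzero $x\in\mathbb{C}^n$ with $\sum_{i_2,\ldots,i_k}\mathcal{Q}(G)_{i\,i_2\cdots i_k}x_{i_2}\cdots x_{i_k}=\lambda x_i^{k-1}$ for all $i$. Then $S_1(m,d,k)\in\mathbb{H}(m,d,k)$, and for every $G\in\mathbb{H}(m,d,k)$ the maximum defining $q(G)$ exists and $q(G)\le q(S_1(m,d,k))$, with equality if and only if $G$ is isomorphic to $S_1(m,d,k)$. -/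

import Mathlib

/-! ### Complex tensors of order `r + 1`, their eigenvalues and spectral radius -/

/-- A complex tensor of order `k` whose `k` indices range over `ι`. -/
abbrev CTensor (k : ℕ) (ι : Type*) := (Fin k → ι) → ℂ

namespace CTensor

/-- For a tensor `A` of order `k = r + 1`, the vector `A x^{k-1}`, with entries
`∑_{i₂,…,i_k} a_{i i₂ … i_k} x_{i₂} ⋯ x_{i_k}`. -/
noncomputable def applyVec {r : ℕ} {ι : Type*} [Fintype ι] (A : CTensor (r + 1) ι) (x : ι → ℂ)
    (i : ι) : ℂ :=
  ∑ f : Fin r → ι, A (Fin.cons i f) * ∏ j, x (f j)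

/-- `μ` is an eigenvalue of the tensor `A` of order `k = r + 1`: the equation
`A x^{k-1} = μ x^{[k-1]}` has a nonzero solution `x`. -/
def IsEigenvalue {r : ℕ} {ι : Type*} [Fintype ι] (A : CTensor (r + 1) ι) (μ : ℂ) : Prop :=
  ∃ x : ι → ℂ, x ≠ 0 ∧ ∀ i, A.applyVec x i = μ * x i ^ r

/-- The set of moduli of the eigenvalues of `A`. -/
def eigenvalueModuli {r : ℕ} {ι : Type*} [Fintype ι] (A : CTensor (r + 1) ι) : Set ℝ :=
  {t | ∃ μ : ℂ, A.IsEigenvalue μ ∧ t = ‖μ‖}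

/-- The spectral radius: the largest modulus of an eigenvalue. -/
noncomputable def spectralRadius {r : ℕ} {ι : Type*} [Fintype ι] (A : CTensor (r + 1) ι) : ℝ :=
  sSup A.eigenvalueModuli

end CTensor

namespace Hypergraph

/-! ### Paths, distance, diameter, degree, isomorphism -/

/-- There is a path `u = x₀, e₀, x₁, …, e_{l-1}, x_l = v` of length `l` in `G`, with distinct
vertices and distinct edges, consecutive vertices lying in the edge between them. -/
def HasPath {α : Type*} (G : Hypergraph α) (u v : α) (l : ℕ) : Prop :=
  ∃ (x : Fin (l + 1) → α) (e : Fin l → Set α),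
    Function.Injective x ∧ Function.Injective e ∧
    (∀ i, x i ∈ G.vertexSet) ∧ (∀ i, e i ∈ G.edgeSet) ∧
    (∀ i, x i.castSucc ∈ e i ∧ x i.succ ∈ e i) ∧
    x 0 = u ∧ x (Fin.last l) = v

/-- Any two vertices are joined by a path. -/
def IsConnected {α : Type*} (G : Hypergraph α) : Prop :=
  ∀ u ∈ G.vertexSet, ∀ v ∈ G.vertexSet, ∃ l, G.HasPath u v l

/-- The length of a shortest path between two vertices. -/
noncomputable def pathDist {α : Type*} (G : Hypergraph α) (u v : α) : ℕ :=
  sInf {l | G.HasPath u v l}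

/-- `G` is connected and `d` is the maximum distance between two of its vertices. -/
def HasDiameter {α : Type*} (G : Hypergraph α) (d : ℕ) : Prop :=
  G.IsConnected ∧
    IsGreatest {l | ∃ u ∈ G.vertexSet, ∃ v ∈ G.vertexSet, l = G.pathDist u v} d

/-- The number of edges that contain `v`. -/
noncomputable def vertexDegree {α : Type*} (G : Hypergraph α) (v : α) : ℕ :=
  {e ∈ G.edgeSet | v ∈ e}.ncard

/-- There is a bijection of the vertex sets under which the edges of `G` and of `H` correspond. -/
def Isomorphic {α β : Type*} (G : Hypergraph α) (H : Hypergraph β) : Prop :=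
  ∃ φ : G.vertexSet ≃ H.vertexSet, ∀ s : Set G.vertexSet,
    (Subtype.val '' s ∈ G.edgeSet ↔ Subtype.val '' (φ '' s) ∈ H.edgeSet)

/-! ### The signless Laplacian tensor -/

open Classical in
/-- The adjacency tensor (of order `r + 1`) of an `(r + 1)`-uniform hypergraph. -/
noncomputable def adjacencyTensor {α : Type*} (G : Hypergraph α) (r : ℕ) :
    CTensor (r + 1) G.vertexSet :=
  fun f => if Set.range (fun j => (f j : α)) ∈ G.edgeSet then 1 / (r.factorial : ℂ) else 0

open Classical in
/-- The diagonal tensor of order `r + 1` of vertex degrees. -/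
noncomputable def degreeTensor {α : Type*} (G : Hypergraph α) (r : ℕ) :
    CTensor (r + 1) G.vertexSet :=
  fun f => if ∀ j, f j = f 0 then (G.vertexDegree (f 0 : α) : ℂ) else 0

/-- The signless Laplacian tensor `Q = D + A`, of order `r + 1`. -/
noncomputable def signlessLaplacianTensor {α : Type*} (G : Hypergraph α) (r : ℕ) :
    CTensor (r + 1) G.vertexSet :=
  fun f => G.degreeTensor r f + G.adjacencyTensor r f

/-- The moduli of the signless Laplacian eigenvalues of a `k`-uniform hypergraph (`1 ≤ k`). -/
noncomputable def signlessModuli {α : Type*} [Finite α] (k : ℕ) (G : Hypergraph α) : Set ℝ :=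
  letI : Fintype G.vertexSet := Fintype.ofFinite _
  (G.signlessLaplacianTensor (k - 1)).eigenvalueModuli

/-- The signless Laplacian spectral radius `q(G)` of a `k`-uniform hypergraph (`1 ≤ k`). -/
noncomputable def signlessRadius {α : Type*} [Finite α] (k : ℕ) (G : Hypergraph α) : ℝ :=
  letI : Fintype G.vertexSet := Fintype.ofFinite _
  (G.signlessLaplacianTensor (k - 1)).spectralRadius

/-! ### Powers of graphs and hypertrees -/

/-- The `k`-th power of a graph `T` (for `k ≥ 3`): `k - 2` new vertices, written `Sum.inr (e, j)`,
are added to each edge `e` of `T`. -/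
def graphPower {W : Type*} (T : SimpleGraph W) (k : ℕ) :
    Hypergraph (W ⊕ (T.edgeSet × Fin (k - 2))) where
  vertexSet := Set.univ
  edgeSet := Set.range fun e : T.edgeSet =>
    (Sum.inl '' {w : W | w ∈ (e : Sym2 W)}) ∪ Set.range fun j : Fin (k - 2) => Sum.inr (e, j)
  subset_vertexSet_of_mem_edgeSet' := fun _ _ => Set.subset_univ _

/-- `G` is (up to isomorphism) the `k`-th power of a finite tree. -/
def IsHypertree {α : Type*} (k : ℕ) (G : Hypergraph α) : Prop :=
  ∃ (n : ℕ) (T : SimpleGraph (Fin n)), T.IsTree ∧ G.Isomorphic (graphPower T k)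

/-- The `k`-uniform hypertrees with `m` edges and diameter `d` whose vertices are taken
from `V`. -/
def hypertrees (V : Type*) (m d k : ℕ) : Set (Hypergraph V) :=
  {G | G.IsHypertree k ∧ G.edgeSet.ncard = m ∧ G.HasDiameter d}

/-- The vertices of `S₁(m, d, k)`: the path vertices `v_{i+1}` (`0 ≤ i ≤ d`), then the `k - 2`
further vertices of each of the `d` path edges, then the `k - 1` new vertices of each of
the `m - d` attached edges. -/
abbrev S1Vertex (m d k : ℕ) :=
  Fin (d + 1) ⊕ ((Fin d × Fin (k - 2)) ⊕ (Fin (m - d) × Fin (k - 1)))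

/-- The `i`-th edge (counted from `0`) of the loose path of length `d`. -/
def S1PathEdge (m d k : ℕ) (i : Fin d) : Set (S1Vertex m d k) :=
  {Sum.inl i.castSucc, Sum.inl i.succ} ∪
    Set.range fun j : Fin (k - 2) => Sum.inr (Sum.inl (i, j))

/-- The `t`-th edge attached at the path vertex `v_{⌊d/2⌋+1}`, which has index `⌊d/2⌋` here. -/
def S1AttachedEdge (m d k : ℕ) (t : Fin (m - d)) : Set (S1Vertex m d k) :=
  {Sum.inl ⟨d / 2, Nat.lt_succ_of_le (Nat.div_le_self d 2)⟩} ∪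
    Set.range fun j : Fin (k - 1) => Sum.inr (Sum.inr (t, j))

/-- `S₁(m, d, k)`: a `k`-uniform loose path `v₁, e₁, v₂, …, v_d, e_d, v_{d+1}` with `m - d` pendent
edges attached at `v_{⌊d/2⌋+1}`. -/
def S1 (m d k : ℕ) : Hypergraph (S1Vertex m d k) where
  vertexSet := Set.univ
  edgeSet := Set.range (S1PathEdge m d k) ∪ Set.range (S1AttachedEdge m d k)
  subset_vertexSet_of_mem_edgeSet' := fun _ _ => Set.subset_univ _

end Hypergraph

/-! Up to a factor k, the polynomial map of the signless Laplacian tensor is the gradient of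
`edgeForm`. Compactness and a first variation show that the largest modulus of an eigenvalue exists
and is the maximum of `edgeForm` over ∑ x_i^k for nonnegative nonzero x
(`exists_isGreatest_edgeModuli`).

In the k-th power of a tree T the k - 2 new vertices of an edge lie in that edge only, so their
values can be optimised away. If q > 1, c > 0 and c²(q - 1)^(k-2) = 1, then by AM-GM the maximum of
`edgeForm` - q ∑ x_i^k over these values is ∑ (z_u² + z_v² + 2c z_u z_v) - q ∑ z_w², where z =
x^(k/2) on T and the first sum runs over the edges of T. So q(G) can be compared with q through a
quadratic form on T (`Represents.signlessRadius_spec`). Suppose q = q(G) ≥ q(S₁), with c determined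
by q. Then the form of T attains q ∑ z², while the form of the broom (a path of length d with m - d
pendent vertices at its centre) never exceeds it. This forces T to be the broom
(`exists_equiv_broom`). Hence q(G) ≥ q(S₁) implies G ≅ S₁, and the invariance of q under isomorphism
yields both the inequality and the equality case.

The comparison of T with the broom has two steps. Let z be a maximizer on T, which is positive, and
let w be a vertex with the largest value. Root T at w, so that each edge belongs to its lower end.
The edges of a path of length d belong to all of its vertices but one, say the j-th. Put z_w at the
j-th place of the path and attach every vertex left over to that place. All vertices are still used
once, no edge term decreases, and the result is a broom whose pendent vertices sit at a place j of
largest value.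

Next, polarization by the reflection i ↦ 2j + 1 - i moves the larger value of each mirror pair to
the right. It preserves ∑ z², does not decrease the path terms, and carries the largest value, and
with it the pendent vertices, from j to j + 1 (`broomForm_le`). After finitely many steps the centre
d / 2 is reached. In the case of equality the limiting values satisfy eigenvalue equations. These
make the centre a strict maximum (`broom_center_strict_max`) and exclude a tight polarization
(`polar_not_tight`), so nothing was moved and T is the broom. -/

namespace Hypergraph

open Finset

/-! ### Indexed edge families and the tensor written edge by edge -/

/-- The edges of `G` correspond, under a bijection of its vertex set with `ι`, to the sets `E j`. -/
def Represents {α ι J : Type*} (G : Hypergraph α) (E : J → Finset ι) : Prop :=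
  Function.Injective E ∧ ∃ φ : G.vertexSet ≃ ι, ∀ s : Set G.vertexSet,
    Subtype.val '' s ∈ G.edgeSet ↔ ∃ j, φ '' s = E j

theorem Represents.of_isomorphic {α β ι J : Type*} {G : Hypergraph α} {H : Hypergraph β}
    {E : J → Finset ι} (h : H.Represents E) (hGH : G.Isomorphic H) : G.Represents E := by
  obtain ⟨hE, φ, hφ⟩ := h
  obtain ⟨ψ, hψ⟩ := hGH
  refine ⟨hE, ψ.trans φ, fun s => ?_⟩
  rw [hψ, hφ]
  simp [Set.image_image]

theorem Represents.isomorphic {α β ι J : Type*} {G : Hypergraph α} {H : Hypergraph β}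
    {E : J → Finset ι} (hG : G.Represents E) (hH : H.Represents E) : G.Isomorphic H := by
  obtain ⟨-, φ, hφ⟩ := hG
  obtain ⟨-, ψ, hψ⟩ := hH
  refine ⟨φ.trans ψ.symm, fun s => ?_⟩
  rw [hψ, hφ]
  simp [Set.image_image]

theorem Represents.reindex {α ι ι' J J' : Type*} {G : Hypergraph α}
    {E : J → Finset ι} {E' : J' → Finset ι'} (h : G.Represents E) (hE' : Function.Injective E')
    (a : ι ≃ ι') (b : J ≃ J') (hab : ∀ j, (E' (b j) : Set ι') = a '' E j) : G.Represents E' := by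
  obtain ⟨hE, φ, hφ⟩ := h
  refine ⟨hE', φ.trans a, fun s => ?_⟩
  rw [hφ]
  constructor
  · rintro ⟨j, hj⟩
    exact ⟨b j, by rw [hab, ← hj]; simp [Set.image_image]⟩
  · rintro ⟨j, hj⟩
    refine ⟨b.symm j, ?_⟩
    have h1 := hab (b.symm j)
    rw [b.apply_symm_apply, ← hj] at h1
    have h2 : a '' (φ '' s) = a '' (E (b.symm j)) := by rw [← h1]; simp [Set.image_image]
    exact a.injective.image_injective h2

/-- The polynomial map `x ↦ Q x^{r}` of the signless Laplacian tensor, written edge by edge. -/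
def edgeAction {R ι J : Type*} [CommSemiring R] [Fintype J] [DecidableEq ι]
    (E : J → Finset ι) (r : ℕ) (x : ι → R) (i : ι) : R :=
  ∑ j with i ∈ E j, (x i ^ r + ∏ v ∈ (E j).erase i, x v)

theorem card_functions_with_image {ι : Type*} [Fintype ι] [DecidableEq ι] (r : ℕ) (S : Finset ι)
    (hS : #S = r) : #{g : Fin r → ι | univ.image g = S} = r.factorial := by
  have e0 : Fintype.card (Fin r) = Fintype.card S := by simp [hS]
  have h1 : Fintype.card (Fin r ≃ S) = r.factorial := by
    rw [Fintype.card_equiv (Fintype.equivOfCardEq e0)]; simp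
  rw [← h1, ← Finset.card_univ]
  symm
  refine Finset.card_bij (fun e _ l => (e l : ι)) ?_ ?_ ?_
  · intro e _
    simp only [mem_filter, mem_univ, true_and]
    ext v
    simp only [mem_image, mem_univ, true_and]
    constructor
    · rintro ⟨l, rfl⟩; exact (e l).2
    · intro hv; exact ⟨e.symm ⟨v, hv⟩, by simp⟩
  · intro e _ e' _ h
    ext l
    exact congrFun h l
  · intro g hg
    simp only [mem_filter, mem_univ, true_and] at hg
    have hmem : ∀ l, g l ∈ S := fun l => hg ▸ mem_image_of_mem g (mem_univ l)
    have hsurj : Function.Surjective (fun l => (⟨g l, hmem l⟩ : S)) := by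
      rintro ⟨v, hv⟩
      rw [← hg] at hv
      obtain ⟨l, -, hl⟩ := mem_image.1 hv
      exact ⟨l, Subtype.ext hl⟩
    exact ⟨Equiv.ofBijective _ ((Fintype.bijective_iff_surjective_and_card _).2 ⟨hsurj, e0⟩),
      mem_univ _, rfl⟩

theorem prod_eq_of_image_eq {ι R : Type*} [CommMonoid R] [DecidableEq ι] {r : ℕ} {S : Finset ι}
    (hS : #S = r) {g : Fin r → ι} (hg : univ.image g = S) (y : ι → R) :
    ∏ l, y (g l) = ∏ v ∈ S, y v := by
  have hinj : Function.Injective g := by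
    have h : #(univ.image g) = #(univ : Finset (Fin r)) := by rw [hg, hS]; simp
    simpa using card_image_iff.1 h
  rw [← hg, Finset.prod_image (fun a _ b _ h => hinj h)]

theorem image_cons_eq_iff {ι : Type*} [DecidableEq ι] {r : ℕ} {S : Finset ι}
    (hS : #S = r + 1) (i : ι) (g : Fin r → ι) :
    insert i (univ.image g) = S ↔ i ∈ S ∧ univ.image g = S.erase i := by
  constructor
  · intro h
    have hi : i ∈ S := h ▸ mem_insert_self _ _
    refine ⟨hi, ?_⟩
    have hn : i ∉ univ.image g := by
      intro hmem
      rw [insert_eq_of_mem hmem] at h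
      have := card_image_le (s := (univ : Finset (Fin r))) (f := g)
      rw [h, hS] at this
      simp at this
    rw [← h, erase_insert hn]
  · rintro ⟨hi, h⟩
    rw [h, insert_erase hi]

/-- The index tuples that complete `i` to the edge `S` are the r! orderings of `S.erase i`, which
cancels the factor 1/r! of the adjacency tensor. -/
theorem sum_tensor_edge {ι R : Type*} [Field R] [CharZero R] [Fintype ι] [DecidableEq ι] {r : ℕ}
    {S : Finset ι} (hS : #S = r + 1) (i : ι) (y : ι → R) :
    ∑ g : Fin r → ι, (if insert i (univ.image g) = S then 1 / (r.factorial : R) else 0) *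
      ∏ l, y (g l) = if i ∈ S then ∏ v ∈ S.erase i, y v else 0 := by
  simp only [image_cons_eq_iff hS]
  split_ifs with hi
  · simp only [hi, true_and, ite_mul, zero_mul]
    rw [← Finset.sum_filter]
    have hc : #(S.erase i) = r := by rw [card_erase_of_mem hi, hS]; rfl
    rw [Finset.sum_congr rfl (g := fun _ => 1 / (r.factorial : R) * ∏ v ∈ S.erase i, y v)]
    · rw [sum_const, card_functions_with_image r _ hc, nsmul_eq_mul, ← mul_assoc,
        mul_one_div_cancel (by exact_mod_cast r.factorial_ne_zero), one_mul]
    · intro g hg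
      rw [prod_eq_of_image_eq hc (mem_filter.1 hg).2]
  · simp [hi]

theorem edgeSet_eq_range {α ι J : Type*} {G : Hypergraph α} {E : J → Finset ι}
    {φ : G.vertexSet ≃ ι}
    (hφ : ∀ s : Set G.vertexSet, Subtype.val '' s ∈ G.edgeSet ↔ ∃ j, φ '' s = E j) :
    G.edgeSet = Set.range fun j => Subtype.val '' (φ.symm '' (E j : Set ι)) := by
  ext e
  constructor
  · intro he
    have hval : Subtype.val '' (Subtype.val ⁻¹' e : Set G.vertexSet) = e := by
      simpa using G.subset_vertexSet_of_mem_edgeSet' he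
    obtain ⟨j, hj⟩ := (hφ (Subtype.val ⁻¹' e)).1 (hval.symm ▸ he)
    exact ⟨j, by simp only [← hj, Equiv.symm_image_image, hval]⟩
  · rintro ⟨j, rfl⟩
    exact (hφ _).2 ⟨j, by simp⟩

theorem image_edge_injective {α ι J : Type*} {G : Hypergraph α} {E : J → Finset ι}
    (hE : Function.Injective E) (φ : G.vertexSet ≃ ι) :
    Function.Injective fun j => Subtype.val '' (φ.symm '' (E j : Set ι)) := by
  intro j j' h
  exact hE (Finset.coe_injective
    (φ.symm.injective.image_injective (Subtype.val_injective.image_injective h)))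

theorem Represents.ncard_edgeSet {α ι J : Type*} {G : Hypergraph α}
    {E : J → Finset ι} (h : G.Represents E) : G.edgeSet.ncard = Nat.card J := by
  obtain ⟨hE, φ, hφ⟩ := h
  rw [edgeSet_eq_range hφ, ← Set.image_univ,
    Set.ncard_image_of_injective _ (image_edge_injective hE φ), Set.ncard_univ]

theorem vertexDegree_eq {α ι J : Type*} [Fintype J] [DecidableEq ι] {G : Hypergraph α}
    {E : J → Finset ι} (hE : Function.Injective E) {φ : G.vertexSet ≃ ι}
    (hφ : ∀ s : Set G.vertexSet, Subtype.val '' s ∈ G.edgeSet ↔ ∃ j, φ '' s = E j)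
    (i : G.vertexSet) : G.vertexDegree i = #{j | φ i ∈ E j} := by
  have key : {e ∈ G.edgeSet | (i : α) ∈ e} =
      (fun j => Subtype.val '' (φ.symm '' (E j : Set ι))) '' {j | φ i ∈ E j} := by
    have hmem : ∀ j, (i : α) ∈ Subtype.val '' (φ.symm '' (E j : Set ι)) ↔ φ i ∈ E j := by
      intro j
      rw [Subtype.val_injective.mem_set_image, φ.symm.image_eq_preimage_symm]
      simp
    rw [edgeSet_eq_range hφ]
    ext e
    constructor
    · rintro ⟨⟨j, rfl⟩, hi⟩
      exact ⟨j, (hmem j).1 hi, rfl⟩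
    · rintro ⟨j, hj, rfl⟩
      exact ⟨⟨j, rfl⟩, (hmem j).2 hj⟩
  rw [vertexDegree, key, Set.ncard_image_of_injective _ (image_edge_injective hE φ),
    ← Set.ncard_coe_finset]
  simp

theorem applyVec_signlessLaplacian {α ι J : Type*} [Fintype J] [DecidableEq ι] {G : Hypergraph α}
    [Fintype G.vertexSet]
    {E : J → Finset ι} (hE : Function.Injective E) {φ : G.vertexSet ≃ ι}
    (hφ : ∀ s : Set G.vertexSet, Subtype.val '' s ∈ G.edgeSet ↔ ∃ j, φ '' s = E j) {r : ℕ}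
    (hcard : ∀ j, #(E j) = r + 1) (x : G.vertexSet → ℂ) (i : G.vertexSet) :
    (G.signlessLaplacianTensor r).applyVec x i = edgeAction E r (x ∘ φ.symm) (φ i) := by
  classical
  have : Fintype ι := Fintype.ofEquiv _ φ
  have hdeg : ∑ f : Fin r → G.vertexSet, G.degreeTensor r (Fin.cons i f) * ∏ j, x (f j) =
      (#{j | φ i ∈ E j} : ℂ) * x i ^ r := by
    rw [Finset.sum_eq_single (fun _ => i)]
    · simp [degreeTensor, Fin.forall_fin_succ, vertexDegree_eq hE hφ]
    · intro f _ hf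
      have : ¬ ∀ j, f j = i := fun h => hf (funext h)
      simp [degreeTensor, Fin.forall_fin_succ, this]
    · simp
  have hadj : ∑ f : Fin r → G.vertexSet, G.adjacencyTensor r (Fin.cons i f) * ∏ j, x (f j) =
      ∑ j with φ i ∈ E j, ∏ v ∈ (E j).erase (φ i), (x ∘ φ.symm) v := by
    have h1 : ∀ g : Fin r → ι,
        G.adjacencyTensor r (Fin.cons i (φ.symm ∘ g)) =
          ∑ j, if insert (φ i) (univ.image g) = E j then 1 / (r.factorial : ℂ) else 0 := by
      intro g
      have h2 : (Set.range fun j => ((Fin.cons i (φ.symm ∘ g) : Fin (r + 1) → G.vertexSet) j : α))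
          = Subtype.val '' (insert i (Set.range (φ.symm ∘ g))) := by
        rw [← Set.image_univ, ← Fin.range_cons, ← Set.range_comp, Set.image_univ]; rfl
      have h3 : φ '' (insert i (Set.range (φ.symm ∘ g))) =
          ((insert (φ i) (univ.image g) : Finset ι) : Set ι) := by
        rw [Set.image_insert_eq, ← Set.range_comp]
        simp [← Function.comp_assoc]
      rw [adjacencyTensor, h2, hφ, h3]
      simp only [Finset.coe_inj]
      split_ifs with h
      · obtain ⟨j, hj⟩ := h
        rw [Finset.sum_eq_single j]
        · rw [if_pos hj]
        · intro j' _ hj'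
          rw [if_neg]
          intro h
          exact hj' (hE (h.symm.trans hj))
        · simp
      · symm
        apply Finset.sum_eq_zero
        intro j _
        rw [if_neg fun h' => h ⟨j, h'⟩]
    rw [← (Equiv.arrowCongr (Equiv.refl (Fin r)) φ.symm).sum_comp]
    change ∑ g : Fin r → ι, G.adjacencyTensor r (Fin.cons i (φ.symm ∘ g)) *
      ∏ l, (x ∘ φ.symm) (g l) = _
    simp only [h1, Finset.sum_mul]
    rw [Finset.sum_comm, Finset.sum_filter]
    refine Finset.sum_congr rfl fun j _ => ?_
    exact sum_tensor_edge (hcard j) (φ i) (x ∘ φ.symm)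
  simp only [CTensor.applyVec, signlessLaplacianTensor, add_mul, Finset.sum_add_distrib]
  rw [hdeg, hadj, edgeAction, Finset.sum_add_distrib, Finset.sum_const, nsmul_eq_mul]
  simp

/-- The moduli of the `μ` for which `edgeAction E r x = μ x^{[r]}` has a nonzero solution. -/
def edgeModuli {ι J : Type*} [Fintype J] [DecidableEq ι] (E : J → Finset ι) (r : ℕ) : Set ℝ :=
  {t | ∃ μ : ℂ, (∃ x : ι → ℂ, x ≠ 0 ∧ ∀ i, edgeAction E r x i = μ * x i ^ r) ∧ t = ‖μ‖}

theorem Represents.signlessModuli_eq {α ι J : Type*} [Finite α] [Fintype J] [DecidableEq ι]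
    {G : Hypergraph α} {E : J → Finset ι} (h : G.Represents E) {k : ℕ}
    (hcard : ∀ j, #(E j) = k - 1 + 1) : G.signlessModuli k = edgeModuli E (k - 1) := by
  obtain ⟨hE, φ, hφ⟩ := h
  let _ : Fintype G.vertexSet := Fintype.ofFinite _
  ext t
  refine exists_congr fun μ => and_congr_left fun _ => ?_
  constructor
  · rintro ⟨x, hx, h⟩
    refine ⟨x ∘ φ.symm, ?_, fun i => ?_⟩
    · intro h0
      apply hx
      funext i
      simpa using congrFun h0 (φ i)
    · have := h (φ.symm i)
      rw [applyVec_signlessLaplacian hE hφ hcard] at this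
      simpa using this
  · rintro ⟨x, hx, h⟩
    refine ⟨x ∘ φ, ?_, fun i => ?_⟩
    · intro h0
      apply hx
      funext i
      simpa using congrFun h0 (φ.symm i)
    · have h1 : (x ∘ φ) ∘ φ.symm = x := by funext; simp
      rw [applyVec_signlessLaplacian hE hφ hcard, h1]
      exact h (φ i)

end Hypergraph

/-! ### Variational characterization of the spectral radius -/

namespace Hypergraph

open Finset

/-- The form `x ↦ xᵀ (Q x^{r})` of degree `r + 1`, written edge by edge. -/
def edgeForm {ι J : Type*} [Fintype J] (E : J → Finset ι) (r : ℕ) (x : ι → ℝ) : ℝ :=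
  ∑ j, (∑ v ∈ E j, x v ^ (r + 1) + (r + 1) * ∏ v ∈ E j, x v)

section Form

variable {ι J : Type*} [Fintype ι] [Fintype J] [DecidableEq ι] {E : J → Finset ι} {r : ℕ}

/-- The product over an edge arises once from each of its r + 1 vertices, which explains the
coefficient r + 1 in `edgeForm`. -/
theorem sum_mul_edgeAction (hcard : ∀ j, #(E j) = r + 1) (x : ι → ℝ) :
    ∑ i, x i * edgeAction E r x i = edgeForm E r x := by
  simp only [edgeAction, Finset.mul_sum, Finset.sum_filter]
  rw [Finset.sum_comm, edgeForm]
  refine Finset.sum_congr rfl fun j _ => ?_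
  simp only [mul_ite, mul_zero]
  rw [← Finset.sum_filter]
  simp only [Finset.filter_mem_eq_inter, Finset.univ_inter, mul_add]
  rw [Finset.sum_add_distrib]
  congr 1
  · exact Finset.sum_congr rfl fun i _ => by ring
  · rw [Finset.sum_congr rfl fun i hi => Finset.mul_prod_erase (E j) x hi, Finset.sum_const,
      hcard, nsmul_eq_mul]
    push_cast; rfl

omit [Fintype ι] in
theorem norm_mul_pow_le {x : ι → ℂ} {μ : ℂ} {i : ι}
    (h : edgeAction E r x i = μ * x i ^ r) :
    ‖μ‖ * ‖x i‖ ^ r ≤ edgeAction E r (fun i => ‖x i‖) i := by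
  rw [← norm_pow, ← norm_mul, ← h, edgeAction, edgeAction]
  refine (norm_sum_le _ _).trans (Finset.sum_le_sum fun j _ => ?_)
  refine (norm_add_le _ _).trans ?_
  rw [norm_pow, norm_prod]

/-- All coefficients are nonnegative, so the entrywise modulus of a complex eigenvector satisfies
the eigenvalue equation as an inequality; pairing it with itself gives a test vector for the bound.
-/
theorem norm_le_of_edgeForm_le (hcard : ∀ j, #(E j) = r + 1) {ρ : ℝ}
    (hρ : ∀ x : ι → ℝ, (∀ i, 0 ≤ x i) → edgeForm E r x ≤ ρ * ∑ i, x i ^ (r + 1))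
    {x : ι → ℂ} (hx : x ≠ 0) {μ : ℂ} (h : ∀ i, edgeAction E r x i = μ * x i ^ r) : ‖μ‖ ≤ ρ := by
  have h1 := hρ (fun i => ‖x i‖) (fun i => norm_nonneg _)
  rw [← sum_mul_edgeAction hcard] at h1
  have h2 : ‖μ‖ * ∑ i, ‖x i‖ ^ (r + 1) ≤ ∑ i, ‖x i‖ * edgeAction E r (fun i => ‖x i‖) i := by
    rw [Finset.mul_sum]
    refine Finset.sum_le_sum fun i _ => ?_
    have := mul_le_mul_of_nonneg_left (norm_mul_pow_le (h i)) (norm_nonneg (x i))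
    calc _ = ‖x i‖ * (‖μ‖ * ‖x i‖ ^ r) := by ring
      _ ≤ _ := this
  obtain ⟨i, hi⟩ := Function.ne_iff.1 hx
  have h3 : 0 < ∑ i, ‖x i‖ ^ (r + 1) :=
    Finset.sum_pos' (fun i _ => by positivity) ⟨i, mem_univ _, by
      have : 0 < ‖x i‖ := norm_pos_iff.2 hi
      positivity⟩
  exact le_of_mul_le_mul_right (h2.trans h1) h3

/-- A one-variable stationarity condition on the half-line. -/
theorem stationary_of_le {A B t : ℝ} (hr : 1 ≤ r) (ht : 0 ≤ t) (hB : 0 ≤ B)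
    (h : ∀ s, 0 ≤ s → A * (s ^ (r + 1) - t ^ (r + 1)) + (r + 1) * B * (s - t) ≤ 0) :
    A * t ^ r + B = 0 := by
  have hd : HasDerivAt (fun s : ℝ => A * (s ^ (r + 1) - t ^ (r + 1)) + (r + 1) * B * (s - t))
      ((r + 1) * (A * t ^ r + B)) t := by
    have h1 := (((hasDerivAt_pow (r + 1) t).sub_const (t ^ (r + 1))).const_mul A).add
      (((hasDerivAt_id t).sub_const t).const_mul ((r + 1 : ℝ) * B))
    refine h1.congr_deriv ?_
    rw [Nat.add_sub_cancel]
    push_cast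
    ring
  -- At the boundary point t = 0 only a one-sided condition is available; dividing it by s > 0 and
  -- letting s tend to 0 gives B ≤ 0.
  rcases ht.eq_or_lt with rfl | ht
  · have h0 : (0 : ℝ) ^ r = 0 := zero_pow (by omega)
    rw [h0, mul_zero, zero_add] at hd ⊢
    by_contra hne
    have hpos : 0 < B := lt_of_le_of_ne hB (Ne.symm hne)
    have hcont : Filter.Tendsto (fun s : ℝ => A * s ^ r + (r + 1) * B)
        (nhdsWithin 0 (Set.Ioi 0)) (nhds ((r + 1) * B)) := by
      have : Continuous (fun s : ℝ => A * s ^ r + (r + 1) * B) := by fun_prop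
      have := this.tendsto 0
      simp only [h0, mul_zero, zero_add] at this
      exact this.mono_left nhdsWithin_le_nhds
    have hle : (r + 1 : ℝ) * B ≤ 0 := by
      refine le_of_tendsto hcont ?_
      filter_upwards [self_mem_nhdsWithin] with s hs
      have hs : 0 < s := hs
      have h2 := h s hs.le
      have h3 : s * (A * s ^ r + (r + 1) * B) ≤ 0 := by
        have h4 : (0 : ℝ) ^ (r + 1) = 0 := by simp
        rw [h4] at h2
        calc _ = A * (s ^ (r + 1) - 0) + (r + 1) * B * (s - 0) := by ring
          _ ≤ 0 := h2
      exact nonpos_of_mul_nonpos_right h3 hs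
    have : 0 < (r + 1 : ℝ) * B := by positivity
    linarith
  · have hmax : IsLocalMax (fun s : ℝ => A * (s ^ (r + 1) - t ^ (r + 1)) +
        (r + 1) * B * (s - t)) t := by
      filter_upwards [lt_mem_nhds ht] with s hs
      simpa using h s hs.le
    have h0 := hmax.hasDerivAt_eq_zero hd
    have hr' : (r + 1 : ℝ) ≠ 0 := by positivity
    exact (mul_eq_zero.1 h0).resolve_left hr'

omit [Fintype ι] in
theorem edgeForm_update (x : ι → ℝ) (i : ι) (s : ℝ) :
    edgeForm E r (Function.update x i s) - edgeForm E r x =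
      #{j | i ∈ E j} * (s ^ (r + 1) - x i ^ (r + 1)) +
        (r + 1) * (∑ j with i ∈ E j, ∏ v ∈ (E j).erase i, x v) * (s - x i) := by
  have key : ∀ j, (∑ v ∈ E j, Function.update x i s v ^ (r + 1) +
        (r + 1) * ∏ v ∈ E j, Function.update x i s v) -
      (∑ v ∈ E j, x v ^ (r + 1) + (r + 1) * ∏ v ∈ E j, x v) =
      if i ∈ E j then (s ^ (r + 1) - x i ^ (r + 1)) +
        (r + 1) * (∏ v ∈ (E j).erase i, x v) * (s - x i) else 0 := by
    intro j
    split_ifs with hi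
    · have hne : ∀ v ∈ (E j).erase i, Function.update x i s v = x v := fun v hv =>
        Function.update_of_ne (Finset.ne_of_mem_erase hv) _ _
      rw [← Finset.add_sum_erase _ _ hi, ← Finset.add_sum_erase _ _ hi,
        ← Finset.mul_prod_erase _ _ hi, ← Finset.mul_prod_erase _ x hi,
        Finset.sum_congr rfl fun v hv => by rw [hne v hv],
        Finset.prod_congr rfl hne, Function.update_self]
      ring
    · have hne : ∀ v ∈ E j, Function.update x i s v = x v := fun v hv =>
        Function.update_of_ne (fun h => hi (by rwa [h] at hv)) _ _
      rw [Finset.sum_congr rfl fun v hv => by rw [hne v hv], Finset.prod_congr rfl hne, sub_self]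
  rw [edgeForm, edgeForm, ← Finset.sum_sub_distrib, Finset.sum_congr rfl fun j _ => key j,
    ← Finset.sum_filter, Finset.sum_add_distrib, Finset.sum_const, nsmul_eq_mul,
    ← Finset.sum_mul, ← Finset.mul_sum]

/-- Each coordinate is varied separately on the half-line. Coordinates equal to 0 are covered too,
so no positivity of the maximizer is needed. -/
theorem edgeAction_eq_of_isMax (hr : 1 ≤ r) {ρ : ℝ}
    (hρ : ∀ x : ι → ℝ, (∀ i, 0 ≤ x i) → edgeForm E r x ≤ ρ * ∑ i, x i ^ (r + 1))
    {x : ι → ℝ} (hx : ∀ i, 0 ≤ x i) (hmax : edgeForm E r x = ρ * ∑ i, x i ^ (r + 1)) (i : ι) :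
    edgeAction E r x i = ρ * x i ^ r := by
  have h := stationary_of_le (A := #{j | i ∈ E j} - ρ)
    (B := ∑ j with i ∈ E j, ∏ v ∈ (E j).erase i, x v) hr (hx i)
    (Finset.sum_nonneg fun j _ => Finset.prod_nonneg fun v _ => hx v) (by
      intro s hs
      have h1 := hρ (Function.update x i s) (by
        intro v
        rcases eq_or_ne v i with rfl | hv
        · simpa using hs
        · simpa [hv] using hx v)
      have h2 := edgeForm_update (E := E) (r := r) x i s
      have h3 : ∑ v, Function.update x i s v ^ (r + 1) =
          ∑ v, x v ^ (r + 1) + (s ^ (r + 1) - x i ^ (r + 1)) := by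
        rw [← Finset.add_sum_erase _ _ (mem_univ i), ← Finset.add_sum_erase _ _ (mem_univ i),
          Finset.sum_congr rfl fun v hv => by
            rw [Function.update_of_ne (Finset.ne_of_mem_erase hv)], Function.update_self]
        ring
      rw [h3] at h1
      linear_combination h1 - h2 - hmax)
  rw [edgeAction, Finset.sum_add_distrib, Finset.sum_const, nsmul_eq_mul]
  linear_combination h

omit [Fintype ι] [DecidableEq ι] in
theorem edgeForm_const_mul (hcard : ∀ j, #(E j) = r + 1) (c : ℝ) (x : ι → ℝ) :
    edgeForm E r (fun i => c * x i) = c ^ (r + 1) * edgeForm E r x := by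
  rw [edgeForm, edgeForm, Finset.mul_sum]
  refine Finset.sum_congr rfl fun j _ => ?_
  rw [Finset.prod_mul_distrib, Finset.prod_const, hcard,
    Finset.sum_congr rfl fun v _ => mul_pow c (x v) (r + 1), ← Finset.mul_sum]
  ring

/-- The quotient is homogeneous of degree 0, so its maximum over the compact standard simplex is its
maximum over all nonnegative nonzero vectors. -/
theorem exists_edgeForm_max [Nonempty ι] (hcard : ∀ j, #(E j) = r + 1) :
    ∃ ρ : ℝ, (∀ x : ι → ℝ, (∀ i, 0 ≤ x i) → edgeForm E r x ≤ ρ * ∑ i, x i ^ (r + 1)) ∧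
      ∃ x : ι → ℝ, x ≠ 0 ∧ (∀ i, 0 ≤ x i) ∧ edgeForm E r x = ρ * ∑ i, x i ^ (r + 1) := by
  have hpos : ∀ x ∈ stdSimplex ℝ ι, 0 < ∑ i, x i ^ (r + 1) := by
    rintro x ⟨h0, h1⟩
    obtain ⟨i, -, hi⟩ := Finset.exists_ne_zero_of_sum_ne_zero (h1.trans_ne one_ne_zero)
    exact Finset.sum_pos' (fun i _ => pow_nonneg (h0 i) _)
      ⟨i, mem_univ _, pow_pos (lt_of_le_of_ne (h0 i) (Ne.symm hi)) _⟩
  have hcont : ContinuousOn (fun x : ι → ℝ => edgeForm E r x / ∑ i, x i ^ (r + 1))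
      (stdSimplex ℝ ι) := by
    refine ContinuousOn.div ?_ ?_ fun x hx => (hpos x hx).ne'
    · unfold edgeForm; fun_prop
    · fun_prop
  obtain ⟨x, hx, hmax⟩ := (isCompact_stdSimplex ℝ ι).exists_isMaxOn
    (by classical exact ⟨_, single_mem_stdSimplex ℝ (Classical.arbitrary ι)⟩) hcont
  refine ⟨edgeForm E r x / ∑ i, x i ^ (r + 1), fun y hy => ?_, x, ?_, hx.1, ?_⟩
  · rcases (Finset.sum_nonneg fun i (_ : i ∈ univ) => hy i).eq_or_lt with h0 | h0
    · have hy0 : y = 0 := by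
        funext i
        exact (Finset.sum_eq_zero_iff_of_nonneg fun i _ => hy i).1 h0.symm i (mem_univ i)
      subst hy0
      have := edgeForm_const_mul hcard 0 (0 : ι → ℝ)
      simp only [zero_mul, zero_pow r.succ_ne_zero] at this
      change edgeForm E r (fun _ => 0) ≤ _
      simp [this]
    · set c := ∑ i, y i with hc
      have hmem : (fun i => c⁻¹ * y i) ∈ stdSimplex ℝ ι :=
        ⟨fun i => mul_nonneg (inv_nonneg.2 h0.le) (hy i), by
          rw [← Finset.mul_sum, inv_mul_cancel₀ h0.ne']⟩
      have h1 : edgeForm E r (fun i => c⁻¹ * y i) / ∑ i, (c⁻¹ * y i) ^ (r + 1) ≤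
        edgeForm E r x / ∑ i, x i ^ (r + 1) := hmax hmem
      rw [div_le_iff₀ (hpos _ hmem), edgeForm_const_mul hcard,
        Finset.sum_congr rfl fun i _ => mul_pow c⁻¹ (y i) (r + 1), ← Finset.mul_sum] at h1
      have h2 : 0 < c⁻¹ ^ (r + 1) := by positivity
      refine le_of_mul_le_mul_left (h1.trans_eq ?_) h2
      ring
  · rintro rfl
    have := hpos _ hx
    simp at this
  · rw [div_mul_cancel₀ _ (hpos x hx).ne']

theorem exists_isGreatest_edgeModuli [Nonempty ι] (hr : 1 ≤ r) (hcard : ∀ j, #(E j) = r + 1) :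
    ∃ ρ : ℝ, IsGreatest (edgeModuli E r) ρ ∧
      (∀ x : ι → ℝ, (∀ i, 0 ≤ x i) → edgeForm E r x ≤ ρ * ∑ i, x i ^ (r + 1)) ∧
      ∃ x : ι → ℝ, x ≠ 0 ∧ (∀ i, 0 ≤ x i) ∧ edgeForm E r x = ρ * ∑ i, x i ^ (r + 1) := by
  obtain ⟨ρ, hρ, x, hx0, hx, hmax⟩ := exists_edgeForm_max (E := E) (r := r) hcard
  have hρ0 : 0 ≤ ρ := by
    have h1 := hρ 1 fun _ => zero_le_one
    have h2 : 0 ≤ edgeForm E r 1 := by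
      unfold edgeForm
      simp only [Pi.one_apply]
      positivity
    have h3 : (0 : ℝ) < Fintype.card ι := by exact_mod_cast Fintype.card_pos
    have h4 := h2.trans h1
    simp only [Pi.one_apply, one_pow, sum_const, card_univ, nsmul_eq_mul, mul_one] at h4
    exact nonneg_of_mul_nonneg_left h4 h3
  refine ⟨ρ, ⟨⟨(ρ : ℂ), ⟨fun i => (x i : ℂ), ?_, fun i => ?_⟩, ?_⟩, ?_⟩, hρ, x, hx0, hx, hmax⟩
  · intro h
    apply hx0
    funext i
    have h1 : (x i : ℂ) = 0 := congrFun h i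
    exact_mod_cast h1
  · have h := edgeAction_eq_of_isMax hr hρ hx hmax i
    rw [edgeAction] at h ⊢
    have h1 := congrArg (fun t : ℝ => (t : ℂ)) h
    push_cast at h1
    exact h1
  · simp [abs_of_nonneg hρ0]
  · rintro t ⟨μ, ⟨x, hx, h⟩, rfl⟩
    exact norm_le_of_edgeForm_le hcard hρ hx h

/-- Testing the form on the indicator of an edge. -/
theorem two_le_of_edgeForm_le [Nonempty J] (hcard : ∀ j, #(E j) = r + 1) {ρ : ℝ}
    (hρ : ∀ x : ι → ℝ, (∀ i, 0 ≤ x i) → edgeForm E r x ≤ ρ * ∑ i, x i ^ (r + 1)) : 2 ≤ ρ := by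
  obtain ⟨j⟩ := ‹Nonempty J›
  have h1 := hρ (fun i => if i ∈ E j then 1 else 0) fun i => by split_ifs <;> norm_num
  have h2 : (2 : ℝ) * (r + 1) ≤ edgeForm E r (fun i => if i ∈ E j then 1 else 0) := by
    refine le_trans ?_ (Finset.single_le_sum (fun j _ => ?_) (mem_univ j))
    · have hv : ∀ v ∈ E j, (if v ∈ E j then (1 : ℝ) else 0) = 1 := fun v hv => if_pos hv
      rw [Finset.prod_congr rfl hv,
        Finset.sum_congr rfl (g := fun _ => (1 : ℝ)) fun v h => by simp [h]]
      simp only [sum_const, hcard, nsmul_eq_mul, prod_const_one]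
      push_cast
      linarith
    · refine add_nonneg (Finset.sum_nonneg fun v _ => ?_)
        (mul_nonneg (by positivity) (Finset.prod_nonneg fun v _ => ?_)) <;> positivity
  have h3 : ∑ i, (if i ∈ E j then (1 : ℝ) else 0) ^ (r + 1) = r + 1 := by
    simp only [ite_pow, one_pow, zero_pow r.succ_ne_zero]
    rw [Finset.sum_ite_mem]
    simp [hcard]
  rw [h3] at h1
  exact le_of_mul_le_mul_right (h2.trans h1) (by positivity)

end Form

end Hypergraph

/-! ### Elimination of the new vertices of a power by AM-GM -/

namespace Hypergraph

open Finset

section PairForm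

variable {W J : Type*}

/-- The value `z_u² + z_v² + 2c z_u z_v` at a pair `s(u, v)`. -/
def pairVal (c : ℝ) (z : W → ℝ) : Sym2 W → ℝ :=
  Sym2.lift ⟨fun u v => z u ^ 2 + z v ^ 2 + 2 * c * (z u * z v), fun u v => by ring⟩

@[simp] theorem pairVal_mk (c : ℝ) (z : W → ℝ) (u v : W) :
    pairVal c z s(u, v) = z u ^ 2 + z v ^ 2 + 2 * c * (z u * z v) := rfl

/-- The quadratic form `∑ (z_u² + z_v² + 2c z_u z_v)`, the sum extending over the edges `s(u, v)`. -/
def pairForm [Fintype J] (ε : J → Sym2 W) (c : ℝ) (z : W → ℝ) : ℝ := ∑ j, pairVal c z (ε j)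

end PairForm

theorem card_mul_le_sum_of_pow_eq_prod {κ : Type*} [Fintype κ] [Nonempty κ] {g : κ → ℝ} {P : ℝ}
    (hg : ∀ i, 0 ≤ g i) (hP : 0 ≤ P) (h : P ^ Fintype.card κ = ∏ i, g i) :
    Fintype.card κ * P ≤ ∑ i, g i := by
  have hK : (0 : ℝ) < Fintype.card κ := by exact_mod_cast Fintype.card_pos
  have h1 := Real.geom_mean_le_arith_mean_weighted univ (fun _ : κ => (Fintype.card κ : ℝ)⁻¹) g
    (fun _ _ => by positivity) (by simp [hK.ne']) (fun i _ => hg i)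
  rw [Real.finsetProd_rpow _ _ fun i _ => hg i, ← h, Real.pow_rpow_inv_natCast hP
    Fintype.card_ne_zero, ← Finset.mul_sum] at h1
  calc _ ≤ Fintype.card κ * ((Fintype.card κ : ℝ)⁻¹ * ∑ i, g i) :=
        mul_le_mul_of_nonneg_left h1 hK.le
    _ = _ := by field_simp

/-- AM-GM for n + 2 numbers: two copies of c z_u z_v and the n numbers (q - 1) y_l^(n+2). The
normalization c²(q - 1)^n = 1 makes their product the (n+2)-th power of x_u x_v ∏ y_l. The factor q
- 1 is what a new vertex leaves in `edgeForm` - q ∑ x^(n+2), its degree being 1. -/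
theorem edge_amgm {n : ℕ} {q c xu xv zu zv : ℝ} {y : Fin n → ℝ} (hq : 1 < q) (hc : 0 < c)
    (hcq : c ^ 2 * (q - 1) ^ n = 1) (hxu : 0 ≤ xu) (hxv : 0 ≤ xv) (hy : ∀ l, 0 ≤ y l)
    (hzu : 0 ≤ zu) (hzv : 0 ≤ zv) (hu : zu ^ 2 = xu ^ (n + 2)) (hv : zv ^ 2 = xv ^ (n + 2)) :
    (n + 2) * (xu * xv * ∏ l, y l) ≤ 2 * c * (zu * zv) + (q - 1) * ∑ l, y l ^ (n + 2) := by
  have hq1 : 0 < q - 1 := by linarith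
  have h := card_mul_le_sum_of_pow_eq_prod (κ := Fin 2 ⊕ Fin n)
    (g := Sum.elim (fun _ => c * (zu * zv)) fun l => (q - 1) * y l ^ (n + 2))
    (P := xu * xv * ∏ l, y l) (by
      rintro (i | l)
      · simp only [Sum.elim_inl]; positivity
      · have := hy l
        simp only [Sum.elim_inr]; positivity)
    (mul_nonneg (mul_nonneg hxu hxv) (Finset.prod_nonneg fun l _ => hy l)) (by
      simp only [Fintype.card_sum, Fintype.card_fin, Fintype.prod_sum_type, Sum.elim_inl,
        Sum.elim_inr, Finset.prod_const, Finset.card_univ, Finset.prod_mul_distrib,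
        Finset.prod_pow]
      rw [add_comm 2 n, mul_pow, mul_pow, ← hu, ← hv]
      linear_combination (-(zu ^ 2 * zv ^ 2 * (∏ l, y l) ^ (n + 2))) * hcq)
  simp only [Fintype.card_sum, Fintype.card_fin, Fintype.sum_sum_type, Sum.elim_inl,
    Sum.elim_inr, Finset.sum_const, Finset.card_univ, nsmul_eq_mul, ← Finset.mul_sum] at h
  push_cast at h
  linarith

section Power

variable {W J : Type*} [DecidableEq W] {n : ℕ}

/-- The edge `ε j` enlarged by the `n` new vertices `(j, 0), …, (j, n - 1)`. -/
def powerEdge (n : ℕ) (ε : J → Sym2 W) (j : J) : Finset (W ⊕ (J × Fin n)) :=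
  (ε j).toFinset.disjSum ({j} ×ˢ univ)

theorem card_powerEdge {ε : J → Sym2 W} (hε : ∀ j, ¬ (ε j).IsDiag) (j : J) :
    #(powerEdge n ε j) = n + 1 + 1 := by
  rw [powerEdge, card_disjSum, Sym2.card_toFinset_of_not_isDiag _ (hε j)]
  simp
  ring

theorem powerEdge_injective (hn : 0 < n) (ε : J → Sym2 W) :
    Function.Injective (powerEdge n ε) := by
  intro j j' h
  have h1 : (Sum.inr (j, ⟨0, hn⟩) : W ⊕ (J × Fin n)) ∈ powerEdge n ε j := by simp [powerEdge]
  rw [h] at h1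
  simpa [powerEdge, eq_comm] using h1

theorem sum_powerEdge {ε : J → Sym2 W} {j : J} {u v : W} (huv : u ≠ v) (h : ε j = s(u, v))
    (g : W ⊕ (J × Fin n) → ℝ) :
    ∑ w ∈ powerEdge n ε j, g w = g (.inl u) + g (.inl v) + ∑ l, g (.inr (j, l)) := by
  rw [powerEdge, Finset.sum_disjSum, h, Sym2.toFinset_mk_eq, Finset.sum_pair huv,
    Finset.sum_product, Finset.sum_singleton]

theorem prod_powerEdge {ε : J → Sym2 W} {j : J} {u v : W} (huv : u ≠ v) (h : ε j = s(u, v))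
    (g : W ⊕ (J × Fin n) → ℝ) :
    ∏ w ∈ powerEdge n ε j, g w = g (.inl u) * g (.inl v) * ∏ l, g (.inr (j, l)) := by
  rw [powerEdge, Finset.prod_disjSum, h, Sym2.toFinset_mk_eq, Finset.prod_pair huv,
    Finset.prod_product, Finset.prod_singleton]

variable [Fintype W] [Fintype J] {ε : J → Sym2 W}

theorem edgeForm_le_pairForm (hε : ∀ j, ¬ (ε j).IsDiag) {q c : ℝ} (hq : 1 < q) (hc : 0 < c)
    (hcq : c ^ 2 * (q - 1) ^ n = 1) {x : W ⊕ (J × Fin n) → ℝ} (hx : ∀ i, 0 ≤ x i) :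
    edgeForm (powerEdge n ε) (n + 1) x - q * ∑ i, x i ^ (n + 1 + 1) ≤
      pairForm ε c (fun w => √(x (.inl w) ^ (n + 2))) -
        q * ∑ w, √(x (.inl w) ^ (n + 2)) ^ 2 := by
  have hsq : ∀ w, √(x (.inl w) ^ (n + 2)) ^ 2 = x (.inl w) ^ (n + 2) := fun w =>
    Real.sq_sqrt (pow_nonneg (hx _) _)
  have hedge : ∀ j, (∑ v ∈ powerEdge n ε j, x v ^ (n + 1 + 1) +
        ((n + 1 : ℕ) + 1) * ∏ v ∈ powerEdge n ε j, x v) ≤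
      pairVal c (fun w => √(x (.inl w) ^ (n + 2))) (ε j) +
        q * ∑ l, x (.inr (j, l)) ^ (n + 2) := by
    intro j
    induction h : ε j with | _ u v
    have huv : u ≠ v := by
      have := hε j
      rwa [h, Sym2.mk_isDiag_iff] at this
    rw [sum_powerEdge huv h, prod_powerEdge huv h, pairVal_mk, hsq, hsq]
    have := edge_amgm hq hc hcq (hx (.inl u)) (hx (.inl v)) (fun l => hx (.inr (j, l)))
      (Real.sqrt_nonneg _) (Real.sqrt_nonneg _) (hsq u) (hsq v)
    push_cast
    linear_combination this
  have h1 := Finset.sum_le_sum fun j (_ : j ∈ univ) => hedge j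
  rw [Finset.sum_add_distrib (f := fun j => pairVal _ _ (ε j)), ← Finset.mul_sum] at h1
  rw [edgeForm, Fintype.sum_sum_type, Fintype.sum_prod_type, pairForm]
  simp only [hsq]
  linear_combination h1

/-- The case of equality in AM-GM: all new vertices of an edge uv receive the value y with (q - 1)
y^(n+2) = c z_u z_v. -/
theorem exists_edgeForm_eq_pairForm (hε : ∀ j, ¬ (ε j).IsDiag) {q c : ℝ} (hq : 1 < q)
    (hc : 0 < c) (hcq : c ^ 2 * (q - 1) ^ n = 1) {z : W → ℝ} (hz : ∀ w, 0 ≤ z w) :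
    ∃ x : W ⊕ (J × Fin n) → ℝ, (∀ i, 0 ≤ x i) ∧ (∀ w, x (.inl w) ^ (n + 2) = z w ^ 2) ∧
      edgeForm (powerEdge n ε) (n + 1) x - q * ∑ i, x i ^ (n + 1 + 1) =
        pairForm ε c z - q * ∑ w, z w ^ 2 := by
  have hq1 : 0 < q - 1 := by linarith
  have hroot : ∀ t : ℝ, 0 ≤ t → ∃ s, 0 ≤ s ∧ s ^ (n + 2) = t := fun t ht =>
    ⟨t ^ ((n + 2 : ℕ) : ℝ)⁻¹, by positivity, Real.rpow_inv_natCast_pow ht (by omega)⟩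
  choose X hX0 hX using fun w => hroot (z w ^ 2) (sq_nonneg _)
  have hpair : ∀ j, ∃ s : ℝ, 0 ≤ s ∧ ∀ u v, ε j = s(u, v) → s ^ (n + 2) = c * (z u * z v) / (q - 1)
      ∧ X u * X v * s ^ n = c * (z u * z v) := by
    intro j
    induction h : ε j with | _ u v
    have hzuv : 0 ≤ c * (z u * z v) := mul_nonneg hc.le (mul_nonneg (hz u) (hz v))
    obtain ⟨s, hs0, hs⟩ := hroot (c * (z u * z v) / (q - 1)) (by positivity)
    have hprod : X u * X v * s ^ n = c * (z u * z v) := by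
      refine (pow_left_inj₀ (mul_nonneg (mul_nonneg (hX0 u) (hX0 v)) (pow_nonneg hs0 n)) hzuv
        (show n + 2 ≠ 0 by omega)).1 ?_
      rw [mul_pow, mul_pow, hX, hX, ← pow_mul, mul_comm n, pow_mul, hs, div_pow, pow_add]
      have : ((q - 1) ^ n)⁻¹ = c ^ 2 := (eq_inv_of_mul_eq_one_left hcq).symm
      rw [div_eq_mul_inv, this]
      ring
    refine ⟨s, hs0, fun u' v' h' => ?_⟩
    rcases Sym2.eq_iff.1 h' with ⟨rfl, rfl⟩ | ⟨rfl, rfl⟩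
    · exact ⟨hs, hprod⟩
    · exact ⟨by rw [hs, mul_comm (z u)], by rw [mul_comm (X v), hprod, mul_comm (z u)]⟩
  choose Y hY0 hY using hpair
  refine ⟨Sum.elim X fun p => Y p.1, ?_, hX, ?_⟩
  · rintro (w | p)
    · exact hX0 w
    · exact hY0 p.1
  · have hedge : ∀ j, (∑ v ∈ powerEdge n ε j, (Sum.elim X fun p => Y p.1 : _ → ℝ) v ^ (n + 1 + 1) +
          ((n + 1 : ℕ) + 1) * ∏ v ∈ powerEdge n ε j, (Sum.elim X fun p => Y p.1 : _ → ℝ) v) =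
        pairVal c z (ε j) + q * ∑ l : Fin n, Y j ^ (n + 2) := by
      intro j
      induction h : ε j with | _ u v
      have huv : u ≠ v := by
        have := hε j
        rwa [h, Sym2.mk_isDiag_iff] at this
      obtain ⟨h1, h2⟩ := hY j u v h
      rw [sum_powerEdge huv h, prod_powerEdge huv h, pairVal_mk]
      simp only [Sum.elim_inl, Sum.elim_inr, Finset.prod_const, Finset.sum_const, card_univ,
        Fintype.card_fin, hX, h2, nsmul_eq_mul]
      rw [show n + 1 + 1 = n + 2 from rfl, h1]
      push_cast
      field_simp
      ring
    rw [edgeForm, Finset.sum_congr rfl fun j _ => hedge j, Finset.sum_add_distrib,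
      ← Finset.mul_sum, Fintype.sum_sum_type, Fintype.sum_prod_type, pairForm]
    simp only [Sum.elim_inl, Sum.elim_inr, hX]
    ring

/-- On a vector that vanishes on the vertices of the graph all edge products vanish and each new
vertex counts once, so the quotient is 1 < q. -/
theorem ne_zero_of_edgeForm_eq (hε : ∀ j, ¬ (ε j).IsDiag) {q : ℝ} (hq : 1 < q)
    {x : W ⊕ (J × Fin n) → ℝ} (hx : ∀ i, 0 ≤ x i) (hx0 : x ≠ 0)
    (h : edgeForm (powerEdge n ε) (n + 1) x = q * ∑ i, x i ^ (n + 1 + 1)) :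
    ∃ w, x (.inl w) ≠ 0 := by
  by_contra! hW
  have h1 : edgeForm (powerEdge n ε) (n + 1) x = ∑ i, x i ^ (n + 1 + 1) := by
    rw [edgeForm, Fintype.sum_sum_type, Fintype.sum_prod_type]
    simp only [hW, zero_pow (Nat.succ_ne_zero _), Finset.sum_const_zero, zero_add]
    refine Finset.sum_congr rfl fun j _ => ?_
    induction h : ε j with | _ u v
    have huv : u ≠ v := by
      have := hε j
      rwa [h, Sym2.mk_isDiag_iff] at this
    rw [sum_powerEdge huv h, prod_powerEdge huv h, hW, hW]
    simp
  obtain ⟨i, hi⟩ := Function.ne_iff.1 hx0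
  have h2 : 0 < ∑ i, x i ^ (n + 1 + 1) :=
    Finset.sum_pos' (fun i _ => pow_nonneg (hx i) _)
      ⟨i, mem_univ _, pow_pos (lt_of_le_of_ne (hx i) (Ne.symm hi)) _⟩
  rw [h1] at h
  nlinarith

/-- Reduction of the spectral radius of a power to the quadratic form of the underlying graph. -/
theorem Represents.signlessRadius_spec {α : Type*} [Finite α] [Nonempty W] [Nonempty J]
    {G : Hypergraph α} {k : ℕ} (hk : 3 ≤ k) (hε : ∀ j, ¬ (ε j).IsDiag)
    (hG : G.Represents (powerEdge (k - 2) ε)) :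
    IsGreatest (G.signlessModuli k) (G.signlessRadius k) ∧ 2 ≤ G.signlessRadius k ∧
    (∀ q c : ℝ, 1 < q → 0 < c → c ^ 2 * (q - 1) ^ (k - 2) = 1 → ∀ z : W → ℝ, (∀ w, 0 ≤ z w) →
      0 < pairForm ε c z - q * ∑ w, z w ^ 2 → q < G.signlessRadius k) ∧
    ∀ c : ℝ, 0 < c → c ^ 2 * (G.signlessRadius k - 1) ^ (k - 2) = 1 →
      ∃ z : W → ℝ, z ≠ 0 ∧ (∀ w, 0 ≤ z w) ∧
        pairForm ε c z = G.signlessRadius k * ∑ w, z w ^ 2 := by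
  classical
  obtain ⟨n, rfl⟩ : ∃ n, k = n + 2 := ⟨k - 2, by omega⟩
  rw [Nat.add_sub_cancel] at hG ⊢
  have hcard := card_powerEdge (n := n) hε
  obtain ⟨ρ, hρ, hmax, x, hx0, hx, hxmax⟩ := exists_isGreatest_edgeModuli (by omega) hcard
  have hmod : G.signlessModuli (n + 2) = edgeModuli (powerEdge n ε) (n + 1) :=
    hG.signlessModuli_eq hcard
  rw [← hmod] at hρ
  have hrad : G.signlessRadius (n + 2) = ρ := hρ.csSup_eq
  rw [hrad]
  have h2 := two_le_of_edgeForm_le hcard hmax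
  have hlt : ∀ q c : ℝ, 1 < q → 0 < c → c ^ 2 * (q - 1) ^ n = 1 → ∀ z : W → ℝ,
      (∀ w, 0 ≤ z w) → 0 < pairForm ε c z - q * ∑ w, z w ^ 2 → q < ρ := by
    intro q c hq hc hcq z hz hpos
    obtain ⟨x, hx, -, h⟩ := exists_edgeForm_eq_pairForm (n := n) hε hq hc hcq hz
    have h1 := hmax x hx
    rw [← h] at hpos
    exact lt_of_mul_lt_mul_right (by linarith)
      (Finset.sum_nonneg fun i (_ : i ∈ univ) => pow_nonneg (hx i) (n + 1 + 1))
  refine ⟨hρ, h2, hlt, fun c hc hcq => ?_⟩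
  have hρ1 : 1 < ρ := by linarith
  refine ⟨fun w => √(x (.inl w) ^ (n + 2)), ?_, fun w => Real.sqrt_nonneg _, le_antisymm ?_ ?_⟩
  · obtain ⟨w, hw⟩ := ne_zero_of_edgeForm_eq hε hρ1 hx hx0 hxmax
    intro h
    have hpos : 0 < x (.inl w) := lt_of_le_of_ne (hx _) (Ne.symm hw)
    exact (Real.sqrt_pos.2 (pow_pos hpos (n + 2))).ne' (congrFun h w)
  · by_contra! hlt'
    exact lt_irrefl _ (hlt ρ c hρ1 hc hcq _ (fun w => Real.sqrt_nonneg _) (sub_pos.2 hlt'))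
  · have := edgeForm_le_pairForm hε hρ1 hc hcq hx
    linarith

end Power

end Hypergraph

/-! ### Brooms: polarization and the equations of a maximizer -/

namespace Hypergraph

open Finset

/-- `x² + y² + 2cxy`. -/
def edgeVal (c x y : ℝ) : ℝ := x ^ 2 + y ^ 2 + 2 * c * (x * y)

section Broom

variable {B : Type*} [Fintype B] {c q : ℝ} {d : ℕ}

/-- The quadratic form of the graph which consists of a path `0, …, d` with values `a` and of
further vertices with values `b` which are adjacent to the path vertex `j`. -/
def broomForm (d : ℕ) (c : ℝ) (j : ℕ) (a : ℕ → ℝ) (b : B → ℝ) : ℝ :=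
  ∑ i ∈ range d, edgeVal c (a i) (a (i + 1)) + ∑ t, edgeVal c (b t) (a j)

/-- The sum of the squares of the values on the path `0, …, d` and on `B`. -/
def broomSq (d : ℕ) (a : ℕ → ℝ) (b : B → ℝ) : ℝ :=
  ∑ i ∈ range (d + 1), a i ^ 2 + ∑ t, b t ^ 2

/-! ### Polarization of sequences -/

/-- Polarization with respect to the reflection `i ↦ 2j + 1 - i`: the larger value of each pair is
moved to the right. -/
noncomputable def polar (j : ℕ) (a : ℕ → ℝ) (i : ℕ) : ℝ :=
  if i ≤ j then min (a i) (a (2 * j + 1 - i))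
  else if i ≤ 2 * j + 1 then max (a i) (a (2 * j + 1 - i)) else a i

theorem polar_left {j i : ℕ} (h : i ≤ j) (a : ℕ → ℝ) :
    polar j a i = min (a i) (a (2 * j + 1 - i)) := if_pos h

theorem polar_right {j i : ℕ} (h : i ≤ j) (a : ℕ → ℝ) :
    polar j a (2 * j + 1 - i) = max (a i) (a (2 * j + 1 - i)) := by
  rw [polar, if_neg (by omega), if_pos (by omega), max_comm]
  congr 2
  omega

theorem polar_outside {j i : ℕ} (h : 2 * j + 1 < i) (a : ℕ → ℝ) : polar j a i = a i := by
  rw [polar, if_neg (by omega), if_neg (by omega)]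

theorem polar_pos {j : ℕ} {a : ℕ → ℝ} (ha : ∀ i, 0 < a i) (i : ℕ) : 0 < polar j a i := by
  unfold polar
  split_ifs
  · exact lt_min (ha _) (ha _)
  · exact lt_max_of_lt_left (ha _)
  · exact ha _

theorem polar_le {j : ℕ} {a : ℕ → ℝ} {M : ℝ} (hj : 2 * j + 1 ≤ d) (ha : ∀ i ≤ d, a i ≤ M) {i : ℕ}
    (hi : i ≤ d) : polar j a i ≤ M := by
  unfold polar
  split_ifs
  · exact (min_le_left _ _).trans (ha _ hi)
  · exact max_le (ha _ hi) (ha _ (by omega))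
  · exact ha _ hi

theorem sum_range_even (g : ℕ → ℝ) (j : ℕ) :
    ∑ i ∈ range (2 * j + 2), g i = ∑ i ∈ range (j + 1), (g i + g (2 * j + 1 - i)) := by
  rw [show 2 * j + 2 = (j + 1) + (j + 1) by ring, Finset.sum_range_add, Finset.sum_add_distrib]
  congr 1
  rw [← Finset.sum_range_reflect]
  refine Finset.sum_congr rfl fun i hi => ?_
  rw [mem_range] at hi
  congr 1
  omega

theorem sum_range_odd (g : ℕ → ℝ) (j : ℕ) :
    ∑ i ∈ range (2 * j + 1), g i = ∑ i ∈ range j, (g i + g (2 * j - i)) + g j := by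
  rw [show 2 * j + 1 = (j + 1) + j by ring, Finset.sum_range_add, Finset.sum_add_distrib,
    Finset.sum_range_succ]
  rw [← Finset.sum_range_reflect (fun i => g (j + 1 + i))]
  have : ∑ i ∈ range j, g (j + 1 + (j - 1 - i)) = ∑ i ∈ range j, g (2 * j - i) := by
    refine Finset.sum_congr rfl fun i hi => ?_
    rw [mem_range] at hi
    congr 1
    omega
  rw [this]
  ring

theorem sum_sq_polar {j : ℕ} (hj : 2 * j + 1 ≤ d) (a : ℕ → ℝ) :
    ∑ i ∈ range (d + 1), polar j a i ^ 2 = ∑ i ∈ range (d + 1), a i ^ 2 := by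
  obtain ⟨e, he⟩ : ∃ e, d + 1 = 2 * j + 2 + e := ⟨d + 1 - (2 * j + 2), by omega⟩
  rw [he, Finset.sum_range_add _ (2 * j + 2), Finset.sum_range_add _ (2 * j + 2), sum_range_even, sum_range_even]
  congr 1
  · refine Finset.sum_congr rfl fun i hi => ?_
    have hi : i ≤ j := by simpa [Nat.lt_succ_iff] using hi
    rw [polar_left hi, polar_right hi]
    rcases le_total (a i) (a (2 * j + 1 - i)) with h | h
    · rw [min_eq_left h, max_eq_right h]
    · rw [min_eq_right h, max_eq_left h, add_comm]
  · exact Finset.sum_congr rfl fun i _ => by rw [polar_outside (by omega)]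

/-- The squares are only rearranged. The products change only if the two mirror pairs are ordered
oppositely, and then the rearrangement inequality gives the gain. -/
theorem edgeVal_polar (c x y x' y' : ℝ) :
    edgeVal c (min x y) (min x' y') + edgeVal c (max x' y') (max x y) -
      (edgeVal c x x' + edgeVal c y' y) = 2 * c * max 0 (-((x - y) * (x' - y'))) := by
  unfold edgeVal
  rcases le_total x y with h | h <;> rcases le_total x' y' with h' | h' <;>
    simp only [min_eq_left, min_eq_right, max_eq_left, max_eq_right, h, h']
  · rw [max_eq_left (by nlinarith)]; ring
  · rw [max_eq_right (by nlinarith)]; ring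
  · rw [max_eq_right (by nlinarith)]; ring
  · rw [max_eq_left (by nlinarith)]; ring

/-- The gain in the path part of the form under polarization. -/
theorem sum_edgeVal_polar {j : ℕ} (hj : 2 * j + 2 ≤ d) (a : ℕ → ℝ) :
    ∑ i ∈ range d, edgeVal c (polar j a i) (polar j a (i + 1)) -
      ∑ i ∈ range d, edgeVal c (a i) (a (i + 1)) =
    ∑ i ∈ range j, 2 * c *
        max 0 (-((a i - a (2 * j + 1 - i)) * (a (i + 1) - a (2 * j + 1 - (i + 1))))) +
      (edgeVal c (max (a 0) (a (2 * j + 1))) (a (2 * j + 2)) -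
        edgeVal c (a (2 * j + 1)) (a (2 * j + 2))) := by
  obtain ⟨e, rfl⟩ : ∃ e, d = 2 * j + 1 + 1 + e := ⟨d - (2 * j + 2), by omega⟩
  -- The reflection pairs the edges inside the window 0, …, 2j + 1 and fixes the middle one. The
  -- edge from 2j + 1 to 2j + 2 has no mirror image and gives the last term; the edges beyond it are
  -- unchanged.
  rw [Finset.sum_range_add _ (2 * j + 1 + 1), Finset.sum_range_add _ (2 * j + 1 + 1),
    Finset.sum_range_succ _ (2 * j + 1), Finset.sum_range_succ _ (2 * j + 1), sum_range_odd,
    sum_range_odd]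
  have h1 : ∑ i ∈ range e, edgeVal c (polar j a (2 * j + 1 + 1 + i))
      (polar j a (2 * j + 1 + 1 + i + 1)) =
      ∑ i ∈ range e, edgeVal c (a (2 * j + 1 + 1 + i)) (a (2 * j + 1 + 1 + i + 1)) :=
    Finset.sum_congr rfl fun i _ => by rw [polar_outside (by omega), polar_outside (by omega)]
  have h2 : edgeVal c (polar j a (2 * j + 1)) (polar j a (2 * j + 1 + 1)) =
      edgeVal c (max (a 0) (a (2 * j + 1))) (a (2 * j + 2)) := by
    have := polar_right (Nat.zero_le j) a
    rw [Nat.sub_zero] at this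
    rw [this, polar_outside (by omega)]
  have h3 : edgeVal c (polar j a j) (polar j a (j + 1)) = edgeVal c (a j) (a (j + 1)) := by
    have h4 := polar_right le_rfl (j := j) a
    have h5 : 2 * j + 1 - j = j + 1 := by omega
    rw [h5] at h4
    rw [h4, polar_left le_rfl, h5]
    unfold edgeVal
    rcases le_total (a j) (a (j + 1)) with h | h
    · rw [min_eq_left h, max_eq_right h]
    · rw [min_eq_right h, max_eq_left h]; ring
  have h4 : ∑ i ∈ range j, (edgeVal c (polar j a i) (polar j a (i + 1)) +
        edgeVal c (polar j a (2 * j - i)) (polar j a (2 * j - i + 1))) -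
      ∑ i ∈ range j, (edgeVal c (a i) (a (i + 1)) +
        edgeVal c (a (2 * j - i)) (a (2 * j - i + 1))) =
      ∑ i ∈ range j, 2 * c *
        max 0 (-((a i - a (2 * j + 1 - i)) * (a (i + 1) - a (2 * j + 1 - (i + 1))))) := by
    rw [← Finset.sum_sub_distrib]
    refine Finset.sum_congr rfl fun i hi => ?_
    rw [mem_range] at hi
    have h5 : 2 * j - i = 2 * j + 1 - (i + 1) := by omega
    have h6 : 2 * j + 1 - (i + 1) + 1 = 2 * j + 1 - i := by omega
    rw [h5, h6, polar_left hi.le, polar_left (show i + 1 ≤ j from hi), polar_right hi.le,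
      polar_right (show i + 1 ≤ j from hi), edgeVal_polar]
  linear_combination h1 + h2 + h3 + h4

theorem edgeVal_mono {x x' y y' : ℝ} (hc : 0 ≤ c) (hx : 0 ≤ x) (hy : 0 ≤ y) (hxx : x ≤ x')
    (hyy : y ≤ y') : edgeVal c x y ≤ edgeVal c x' y' := by
  have hx' := hx.trans hxx
  unfold edgeVal
  gcongr

theorem eq_of_edgeVal_le {x x' y y' : ℝ} (hc : 0 ≤ c) (hx : 0 ≤ x) (hy : 0 ≤ y) (hxx : x ≤ x')
    (hyy : y ≤ y') (h : edgeVal c x' y' ≤ edgeVal c x y) : x = x' ∧ y = y' := by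
  unfold edgeVal at h
  have h1 : x * y ≤ x' * y' := mul_le_mul hxx hyy hy (hx.trans hxx)
  have h2 : 2 * c * (x * y) ≤ 2 * c * (x' * y') := by gcongr
  constructor
  · nlinarith
  · nlinarith

/-! ### The equations of a maximizer -/

/-- This is a first variation at a positive entry δ: the entry may change by any s ≥ -δ without
becoming negative. -/
theorem eq_zero_of_quadratic_le {L K δ : ℝ} (hδ : 0 < δ)
    (h : ∀ s, -δ ≤ s → 2 * s * L + s ^ 2 * K ≤ 0) : L = 0 := by
  have hd : HasDerivAt (fun s : ℝ => 2 * s * L + s ^ 2 * K) (2 * L) 0 := by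
    have h1 := (((hasDerivAt_id (0 : ℝ)).const_mul 2).mul_const L).add
      ((hasDerivAt_pow 2 (0 : ℝ)).mul_const K)
    refine h1.congr_deriv ?_
    simp
  have hmax : IsLocalMax (fun s : ℝ => 2 * s * L + s ^ 2 * K) 0 := by
    filter_upwards [lt_mem_nhds (show -δ < 0 by linarith)] with s hs
    simpa using h s hs.le
  linarith [hmax.hasDerivAt_eq_zero hd]

theorem sum_edgeVal_update (a : ℕ → ℝ) {i : ℕ} (hi : i ≤ d) (s : ℝ) :
    ∑ l ∈ range d, edgeVal c (Function.update a i (a i + s) l)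
        (Function.update a i (a i + s) (l + 1)) =
      ∑ l ∈ range d, edgeVal c (a l) (a (l + 1)) +
        2 * s * ((if i < d then a i + c * a (i + 1) else 0) +
          (if 0 < i then a i + c * a (i - 1) else 0)) +
        s ^ 2 * ((if i < d then 1 else 0) + (if 0 < i then 1 else 0)) := by
  have h1 : ∀ l, edgeVal c (Function.update a i (a i + s) l)
      (Function.update a i (a i + s) (l + 1)) = edgeVal c (a l) (a (l + 1)) +
        ((if i = l then 2 * s * (a i + c * a (i + 1)) + s ^ 2 else 0) +
        (if i = l + 1 then 2 * s * (a i + c * a (i - 1)) + s ^ 2 else 0)) := by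
    intro l
    unfold edgeVal
    by_cases h : i = l
    · subst h
      simp
      ring
    · by_cases h' : i = l + 1
      · subst h'
        simp
        ring
      · rw [Function.update_of_ne (Ne.symm h), Function.update_of_ne (Ne.symm h'), if_neg h,
          if_neg h']
        ring
  have h2 : ∑ l ∈ range d, (if i = l + 1 then 2 * s * (a i + c * a (i - 1)) + s ^ 2 else 0) =
      if 0 < i then 2 * s * (a i + c * a (i - 1)) + s ^ 2 else 0 := by
    rcases i with _ | i
    · simp
    · simp only [Nat.add_right_cancel_iff, Finset.sum_ite_eq, mem_range]
      rw [if_pos (by omega), if_pos (by omega)]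
  rw [Finset.sum_congr rfl fun l _ => h1 l, Finset.sum_add_distrib, Finset.sum_add_distrib, h2,
    Finset.sum_ite_eq]
  simp only [mem_range]
  split_ifs <;> ring

theorem sum_sq_update (a : ℕ → ℝ) {i : ℕ} (hi : i ≤ d) (s : ℝ) :
    ∑ l ∈ range (d + 1), Function.update a i (a i + s) l ^ 2 =
      ∑ l ∈ range (d + 1), a l ^ 2 + 2 * s * a i + s ^ 2 := by
  have h1 : ∀ l, Function.update a i (a i + s) l ^ 2 =
      a l ^ 2 + if i = l then 2 * s * a i + s ^ 2 else 0 := by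
    intro l
    by_cases h : i = l
    · subst h; simp; ring
    · rw [Function.update_of_ne (Ne.symm h), if_neg h, add_zero]
  rw [Finset.sum_congr rfl fun l _ => h1 l, Finset.sum_add_distrib, Finset.sum_ite_eq,
    if_pos (by simpa [Nat.lt_succ_iff] using hi)]
  ring

/-- The quotient of `broomForm` by `broomSq` is bounded by `q`. -/
def BroomBound (B : Type*) [Fintype B] (d : ℕ) (c : ℝ) (h : ℕ) (q : ℝ) : Prop :=
  ∀ (a : ℕ → ℝ) (b : B → ℝ), (∀ i, 0 ≤ a i) → (∀ t, 0 ≤ b t) →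
    broomForm d c h a b ≤ q * broomSq d a b

variable {h : ℕ} {a : ℕ → ℝ} {b : B → ℝ}

theorem broom_path_eq (hS : BroomBound B d c h q)
    (ha : ∀ i, 0 < a i) (hb : ∀ t, 0 < b t) (heq : broomForm d c h a b = q * broomSq d a b)
    {i : ℕ} (hi : i ≤ d) :
    q * a i = (if i < d then a i + c * a (i + 1) else 0) +
      (if 0 < i then a i + c * a (i - 1) else 0) +
      if i = h then ∑ t, (a i + c * b t) else 0 := by
  set L := (if i < d then a i + c * a (i + 1) else 0) +
      (if 0 < i then a i + c * a (i - 1) else 0) with hL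
  set K : ℝ := (if i < d then 1 else 0) + (if 0 < i then 1 else 0) with hK
  have hpend : ∀ s, ∑ t, edgeVal c (b t) (Function.update a i (a i + s) h) =
      ∑ t, edgeVal c (b t) (a h) + 2 * s * (if i = h then ∑ t, (a i + c * b t) else 0) +
        s ^ 2 * (if i = h then (Fintype.card B : ℝ) else 0) := by
    intro s
    by_cases hih : i = h
    · subst hih
      simp only [Function.update_self, if_true, edgeVal]
      rw [Finset.mul_sum, ← Finset.sum_add_distrib]
      have : s ^ 2 * (Fintype.card B : ℝ) = ∑ _t : B, s ^ 2 := by simp [mul_comm]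
      rw [this, ← Finset.sum_add_distrib]
      exact Finset.sum_congr rfl fun t _ => by ring
    · rw [Function.update_of_ne (Ne.symm hih), if_neg hih, if_neg hih]
      ring
  have h0 : (L + (if i = h then ∑ t, (a i + c * b t) else 0)) - q * a i = 0 := by
    refine eq_zero_of_quadratic_le (K := K + (if i = h then (Fintype.card B : ℝ) else 0) - q)
      (ha i) fun s hs => ?_
    have h1 := hS (Function.update a i (a i + s)) b (fun l => by
      rcases eq_or_ne l i with rfl | hl
      · rw [Function.update_self]; linarith
      · rw [Function.update_of_ne hl]; exact (ha l).le) fun t => (hb t).le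
    rw [broomForm, broomSq, sum_edgeVal_update a hi, sum_sq_update a hi, hpend] at h1
    rw [broomForm, broomSq] at heq
    linear_combination h1 - heq
  linear_combination -h0

theorem broom_leaf_eq (hS : BroomBound B d c h q)
    (ha : ∀ i, 0 < a i) (hb : ∀ t, 0 < b t) (heq : broomForm d c h a b = q * broomSq d a b)
    (t : B) : q * b t = b t + c * a h := by
  classical
  have h0 : (b t + c * a h) - q * b t = 0 := by
    refine eq_zero_of_quadratic_le (K := 1 - q) (hb t) fun s hs => ?_
    have h1 := hS a (Function.update b t (b t + s)) (fun i => (ha i).le) fun l => by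
      rcases eq_or_ne l t with rfl | hl
      · rw [Function.update_self]; linarith
      · rw [Function.update_of_ne hl]; exact (hb l).le
    have h2 : ∀ l, edgeVal c (Function.update b t (b t + s) l) (a h) =
        edgeVal c (b l) (a h) + if t = l then 2 * s * (b t + c * a h) + s ^ 2 else 0 := by
      intro l
      unfold edgeVal
      by_cases h : t = l
      · subst h; simp; ring
      · rw [Function.update_of_ne (Ne.symm h), if_neg h, add_zero]
    have h3 : ∀ l, Function.update b t (b t + s) l ^ 2 =
        b l ^ 2 + if t = l then 2 * s * b t + s ^ 2 else 0 := by
      intro l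
      by_cases h : t = l
      · subst h; simp; ring
      · rw [Function.update_of_ne (Ne.symm h), if_neg h, add_zero]
    rw [broomForm, broomSq, Finset.sum_congr rfl fun l _ => h2 l,
      Finset.sum_congr rfl fun l _ => h3 l, Finset.sum_add_distrib, Finset.sum_add_distrib,
      Finset.sum_ite_eq, Finset.sum_ite_eq, if_pos (mem_univ _), if_pos (mem_univ _)] at h1
    rw [broomForm, broomSq] at heq
    linear_combination h1 - heq
  linear_combination -h0

/-- The point is the bound q > 2 + 2c. A path vertex other than the centre that also carried the
maximum M would satisfy q M ≤ 2M + 2cM. For a pendent vertex, (q - 1) b = c M with q > 3 and c ≤ 1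
suffices. -/
theorem broom_center_strict_max [Nonempty B] (hc0 : 0 < c) (hc1 : c ≤ 1) (hh : 0 < h)
    (hhd : h + 1 < d) (hS : BroomBound B d c h q)
    (ha : ∀ i, 0 < a i) (hb : ∀ t, 0 < b t) (heq : broomForm d c h a b = q * broomSq d a b)
    (hmax : ∀ i ≤ d, a i ≤ a h) :
    (∀ i ≤ d, i ≠ h → a i < a h) ∧ ∀ t, b t < a h := by
  have hpath := fun {i : ℕ} (hi : i ≤ d) => broom_path_eq hS ha hb heq hi
  have hleaf := broom_leaf_eq hS ha hb heq
  have hM := ha h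
  have hN : (1 : ℝ) ≤ Fintype.card B := by exact_mod_cast Fintype.card_pos
  have hcenter := hpath (show h ≤ d by omega)
  rw [if_pos (by omega), if_pos hh, if_pos rfl, Finset.sum_add_distrib, ← Finset.mul_sum,
    Finset.sum_const, card_univ, nsmul_eq_mul] at hcenter
  have hbsum : (q - 1) * ∑ t, b t = Fintype.card B * (c * a h) := by
    rw [Finset.mul_sum, Finset.sum_congr rfl fun t _ => show (q - 1) * b t = c * a h by
      linear_combination hleaf t]
    simp
  have hbpos : 0 < ∑ t, b t := Finset.sum_pos (fun t _ => hb t) univ_nonempty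
  have hq3 : 3 < q := by
    have h1 := mul_pos hc0 (ha (h + 1))
    have h2 := mul_pos hc0 (ha (h - 1))
    have h3 := mul_pos hc0 hbpos
    by_contra! hq
    nlinarith
  have hleft : c * a h ≤ (q - 1) * a (h - 1) := by
    have h1 := hpath (show h - 1 ≤ d by omega)
    rw [if_pos (by omega), if_neg (show h - 1 ≠ h by omega), Nat.sub_add_cancel hh] at h1
    split_ifs at h1
    · have := mul_pos hc0 (ha (h - 1 - 1))
      have := ha (h - 1)
      linarith
    · linarith
  have hright : c * a h < (q - 1) * a (h + 1) := by
    have h1 := hpath (show h + 1 ≤ d by omega)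
    rw [if_pos hhd, if_pos (by omega), if_neg (by omega), Nat.add_sub_cancel] at h1
    have := mul_pos hc0 (ha (h + 1 + 1))
    have := ha (h + 1)
    linarith
  -- With N pendent vertices, the central equation times q - 1, with the neighbours bounded below by
  -- their own equations, gives (q - 1)(q - 2 - N) > (2 + N)c². The weakest case is N = 1.
  have hprod : 3 * c ^ 2 < (q - 1) * (q - 3) := by
    have h1 : (q - 1) * (q - 2 - Fintype.card B) * a h = c * ((q - 1) * a (h - 1)) +
        c * ((q - 1) * a (h + 1)) + c * (Fintype.card B * (c * a h)) := by
      rw [← hbsum]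
      linear_combination (q - 1) * hcenter
    have h2 := mul_le_mul_of_nonneg_left hleft hc0.le
    have h3 := mul_lt_mul_of_pos_left hright hc0
    have h4 : (2 + Fintype.card B) * c ^ 2 * a h <
        (q - 1) * (q - 2 - Fintype.card B) * a h := by linarith
    have h5 := lt_of_mul_lt_mul_right h4 hM.le
    nlinarith
  -- At q = 2 + 2c the product (q - 1)(q - 3) is 4c² - 1, which is at most 3c² because c ≤ 1.
  have hq : 2 + 2 * c < q := by nlinarith
  constructor
  · intro i hi hne
    by_contra! hlt
    have hai : a i = a h := le_antisymm (hmax i hi) hlt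
    have h1 := hpath hi
    rw [if_neg hne, hai] at h1
    split_ifs at h1 with h2 h3
    · have h4 := mul_le_mul_of_nonneg_left (hmax (i + 1) (by omega)) hc0.le
      have h5 := mul_le_mul_of_nonneg_left (hmax (i - 1) (by omega)) hc0.le
      nlinarith
    · have h4 := mul_le_mul_of_nonneg_left (hmax (i + 1) (by omega)) hc0.le
      nlinarith
    · have h5 := mul_le_mul_of_nonneg_left (hmax (i - 1) (by omega)) hc0.le
      nlinarith
    · nlinarith
  · intro t
    by_contra! hlt
    have := hleaf t
    nlinarith

/-! ### Moving the pendent vertices towards the centre of the path -/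

/-- The pendent terms cancel: since a_{j+1} ≤ a_j, polarization brings the value a_j to the place j
+ 1, to which the pendent vertices move. -/
theorem broomForm_polar_sub {j : ℕ} (hj : 2 * j + 2 ≤ d) (hmax : a (j + 1) ≤ a j) :
    broomForm d c (j + 1) (polar j a) b - broomForm d c j a b =
    ∑ i ∈ range j, 2 * c *
        max 0 (-((a i - a (2 * j + 1 - i)) * (a (i + 1) - a (2 * j + 1 - (i + 1))))) +
      (edgeVal c (max (a 0) (a (2 * j + 1))) (a (2 * j + 2)) -
        edgeVal c (a (2 * j + 1)) (a (2 * j + 2))) := by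
  have h1 : polar j a (j + 1) = a j := by
    have h4 := polar_right le_rfl (j := j) a
    have h5 : 2 * j + 1 - j = j + 1 := by omega
    rw [h5, max_eq_left hmax] at h4
    exact h4
  rw [← sum_edgeVal_polar hj, broomForm, broomForm, h1]
  ring

/-- Without gain, mirror pairs next to each other are never strictly oppositely ordered. Starting
from the outer end, the equations at the two places of a pair turn each a_i ≤ a_{2j+1-i} into a
strict inequality, and at i = j this contradicts a_{j+1} < a_j. -/
theorem polar_not_tight [Nonempty B] {j : ℕ} (hc0 : 0 < c) (hj : 2 * j + 2 ≤ d)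
    (hS : BroomBound B d c (j + 1) q) (ha : ∀ i, 0 < a i) (hb : ∀ t, 0 < b t)
    (heq : broomForm d c (j + 1) (polar j a) b = q * broomSq d (polar j a) b)
    (hlt : a (j + 1) < a j)
    (htight : ∀ i < j, 0 ≤ (a i - a (2 * j + 1 - i)) * (a (i + 1) - a (2 * j + 1 - (i + 1))))
    (hend : a 0 ≤ a (2 * j + 1)) : False := by
  have hpath := fun {i : ℕ} (hi : i ≤ d) => broom_path_eq hS (polar_pos ha) hb heq hi
  have hle : ∀ i ≤ j, polar j a i ≤ polar j a (2 * j + 1 - i) := fun i hi => by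
    rw [polar_left hi, polar_right hi]; exact min_le_max
  have hmid : 2 * j + 1 - j = j + 1 := by omega
  have key : ∀ i ≤ j, a i < a (2 * j + 1 - i) := by
    intro i
    induction i with
    | zero =>
      intro _
      refine lt_of_le_of_ne hend fun h0 => ?_
      rw [Nat.sub_zero] at h0
      have hj0 : 0 < j := by
        rcases Nat.eq_zero_or_pos j with rfl | h
        · simp at h0; simp at hlt; linarith
        · exact h
      have h1 := hpath (Nat.zero_le d)
      have h2 := hpath (show 2 * j + 1 ≤ d by omega)
      rw [if_pos (by omega), if_neg (by omega), if_neg (by omega)] at h1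
      rw [if_pos (by omega), if_pos (by omega), if_neg (by omega), Nat.add_sub_cancel] at h2
      have h3 : polar j a (2 * j + 1) = polar j a 0 := by
        have := polar_right (Nat.zero_le j) a
        rw [Nat.sub_zero] at this
        rw [this, polar_left (Nat.zero_le j), Nat.sub_zero, ← h0, max_self, min_self]
      have h4 := hle 1 hj0
      rw [Nat.add_sub_cancel] at h4
      rw [h3] at h2
      -- With equal values at 0 and 2j + 1 the two equations are incompatible: 2j + 1 has the
      -- further neighbour 2j + 2, and its inner neighbour is at least as large as that of 0.
      have h5 := mul_le_mul_of_nonneg_left h4 hc0.le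
      have h6 := mul_pos hc0 (polar_pos ha (j := j) (2 * j + 1 + 1))
      have h7 := polar_pos ha (j := j) 0
      rw [zero_add] at h1
      linarith
    | succ i ih =>
      intro hi
      have hlt' := ih (by omega)
      have h1 := htight i (by omega)
      have h2 : a (i + 1) ≤ a (2 * j + 1 - (i + 1)) := by
        by_contra! h
        nlinarith [mul_pos (sub_pos.2 hlt') (sub_pos.2 h)]
      refine lt_of_le_of_ne h2 fun h0 => ?_
      have hij : i + 1 < j := by
        refine lt_of_le_of_ne hi fun h => ?_
        rw [h, hmid] at h0
        linarith
      have e1 : 2 * j + 1 - (i + 1) + 1 = 2 * j + 1 - i := by omega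
      have e2 : 2 * j + 1 - (i + 1) - 1 = 2 * j + 1 - (i + 1 + 1) := by omega
      have h3 := hpath (show i + 1 ≤ d by omega)
      have h4 := hpath (show 2 * j + 1 - (i + 1) ≤ d by omega)
      rw [if_pos (by omega), if_pos (by omega), if_neg (by omega), Nat.add_sub_cancel] at h3
      rw [if_pos (by omega), if_pos (by omega), if_neg (by omega), e1, e2] at h4
      have h5 : polar j a (2 * j + 1 - (i + 1)) = polar j a (i + 1) := by
        rw [polar_right hi, polar_left hi, ← h0, max_self, min_self]
      rw [h5] at h4
      have h6 := hle (i + 1 + 1) hij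
      have h7 : polar j a i < polar j a (2 * j + 1 - i) := by
        rw [polar_left (by omega), polar_right (by omega), min_eq_left hlt'.le,
          max_eq_right hlt'.le]
        exact hlt'
      -- The places i + 1 and 2j - i carry equal values, but of their outer neighbours the right one
      -- is strictly larger and of their inner neighbours the right one is at least as large, so the
      -- two equations differ.
      nlinarith
  have := key j le_rfl
  rw [hmid] at this
  linarith

/-- Induction on the number n of polarizations that bring the pendent vertices to the centre. The
largest value stays at the place of attachment throughout, so the hypotheses pass on to the next
step. -/
theorem broomForm_le [Nonempty B] (hd : 3 ≤ d) (hc0 : 0 < c) (hc1 : c ≤ 1)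
    (hS : BroomBound B d c (d / 2) q) (n : ℕ) :
    ∀ (j : ℕ) (a : ℕ → ℝ) (b : B → ℝ), j + n = d / 2 → (∀ i, 0 < a i) → (∀ t, 0 < b t) →
      (∀ i ≤ d, a i ≤ a j) → (∀ t, b t ≤ a j) →
      broomForm d c j a b ≤ q * broomSq d a b ∧
      (broomForm d c j a b = q * broomSq d a b →
        n = 0 ∧ (∀ i ≤ d, i ≠ j → a i < a j) ∧ ∀ t, b t < a j) := by
  induction n with
  | zero =>
    rintro j a b rfl ha hb hmax -
    exact ⟨hS a b (fun i => (ha i).le) fun t => (hb t).le, fun heq =>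
      ⟨rfl, broom_center_strict_max hc0 hc1 (by omega) (by omega) hS ha hb heq hmax⟩⟩
  | succ n ih =>
    intro j a b hjn ha hb hmax hbmax
    have hj : 2 * j + 2 ≤ d := by omega
    have hj1 : polar j a (j + 1) = a j := by
      have h4 := polar_right le_rfl (j := j) a
      have h5 : 2 * j + 1 - j = j + 1 := by omega
      rw [h5, max_eq_left (hmax _ (by omega))] at h4
      exact h4
    have hsq : broomSq d (polar j a) b = broomSq d a b := by
      rw [broomSq, sum_sq_polar (by omega), broomSq]
    obtain ⟨h1, h2⟩ := ih (j + 1) (polar j a) b (by omega) (polar_pos ha) hb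
      (fun i hi => by rw [hj1]; exact polar_le (by omega) hmax hi)
      (fun t => by rw [hj1]; exact hbmax t)
    rw [hsq] at h1 h2
    have hsub := broomForm_polar_sub (c := c) (b := b) hj (hmax (j + 1) (by omega))
    have hterm : ∀ i ∈ range j, 0 ≤ 2 * c *
        max 0 (-((a i - a (2 * j + 1 - i)) * (a (i + 1) - a (2 * j + 1 - (i + 1))))) :=
      fun i _ => by positivity
    have hsum := Finset.sum_nonneg hterm
    have hlast : edgeVal c (a (2 * j + 1)) (a (2 * j + 2)) ≤
        edgeVal c (max (a 0) (a (2 * j + 1))) (a (2 * j + 2)) :=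
      edgeVal_mono hc0.le (ha _).le (ha _).le (le_max_right _ _) le_rfl
    refine ⟨by linarith, fun heq => ?_⟩
    have heq' : broomForm d c (j + 1) (polar j a) b = q * broomSq d a b := by linarith
    -- Equality passes to the polarized sequence, where by induction no step remains. So only the
    -- last polarization must be excluded, and there the polarized sequence is a maximizer for the
    -- central broom, with its equations available.
    obtain ⟨rfl, h3, -⟩ := h2 heq'
    exfalso
    rw [zero_add] at hjn
    have h4 := h3 j (by omega) (by omega)
    rw [hj1, polar_left le_rfl, show 2 * j + 1 - j = j + 1 by omega, min_lt_iff] at h4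
    have hlt : a (j + 1) < a j := h4.resolve_left (lt_irrefl _)
    have h5 : ∀ i ∈ range j, 2 * c *
        max 0 (-((a i - a (2 * j + 1 - i)) * (a (i + 1) - a (2 * j + 1 - (i + 1))))) = 0 :=
      (Finset.sum_eq_zero_iff_of_nonneg hterm).1 (by linarith)
    have h6 := (eq_of_edgeVal_le hc0.le (ha _).le (ha _).le (le_max_right (a 0) (a (2 * j + 1)))
      (le_refl (a (2 * j + 2))) (by linarith)).1
    refine polar_not_tight hc0 hj (hjn ▸ hS) ha hb (hsq ▸ heq') hlt (fun i hi => ?_)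
      (max_eq_right_iff.1 h6.symm)
    have h7 := (mul_eq_zero.1 (h5 i (mem_range.2 hi))).resolve_left (by positivity)
    have h8 := max_eq_left_iff.1 h7
    linarith

end Broom

end Hypergraph

/-! ### Rooted trees and the edges off a path -/

namespace Hypergraph

open Finset

section Tree

variable {W : Type*} {T : SimpleGraph W}

theorem exists_parent (hT : T.Connected) (w : W) :
    ∃ par : W → W, ∀ v, v ≠ w → T.Adj v (par v) ∧ T.dist w (par v) + 1 = T.dist w v := by
  have key : ∀ v, ∃ u, v ≠ w → T.Adj v u ∧ T.dist w u + 1 = T.dist w v := by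
    intro v
    by_cases hv : v = w
    · exact ⟨v, fun h => absurd hv h⟩
    obtain ⟨p, hp⟩ := hT.exists_walk_length_eq_dist v w
    cases p with
    | nil => exact absurd rfl hv
    | @cons _ u _ hadj p =>
      refine ⟨u, fun _ => ⟨hadj, ?_⟩⟩
      rw [SimpleGraph.Walk.length_cons] at hp
      have h1 := SimpleGraph.dist_le p
      have h2 := hT.dist_triangle (u := v) (v := u) (w := w)
      rw [SimpleGraph.dist_eq_one_iff_adj.2 hadj] at h2
      rw [T.dist_comm (u := w) (v := u), T.dist_comm (u := w) (v := v)]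
      omega
  choose par hpar using key
  exact ⟨par, hpar⟩

/-- Two vertices with the same parent edge would be parents of each other, against the distances to
the root; surjectivity follows by counting, as a tree has one edge fewer than vertices. -/
theorem bijective_parentEdge [Finite W] (hT : T.IsTree) {w : W} {par : W → W}
    (hpar : ∀ v, v ≠ w → T.Adj v (par v) ∧ T.dist w (par v) + 1 = T.dist w v) :
    Function.Bijective
      (fun v : {v // v ≠ w} => (⟨s(v.1, par v.1), (hpar v.1 v.2).1⟩ : T.edgeSet)) := by
  classical
  have := Fintype.ofFinite W
  have hinj : Function.Injective
      (fun v : {v // v ≠ w} => (⟨s(v.1, par v.1), (hpar v.1 v.2).1⟩ : T.edgeSet)) := by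
    rintro ⟨v, hv⟩ ⟨v', hv'⟩ h
    have h1 : s(v, par v) = s(v', par v') := congrArg Subtype.val h
    rcases Sym2.eq_iff.1 h1 with ⟨h2, -⟩ | ⟨h2, h3⟩
    · exact Subtype.ext h2
    · have h4 := (hpar v hv).2
      have h5 := (hpar v' hv').2
      rw [h3] at h4
      rw [← h2] at h5
      omega
  refine (Fintype.bijective_iff_injective_and_card _).2 ⟨hinj, ?_⟩
  have h1 := (SimpleGraph.isTree_iff_connected_and_card.1 hT).2
  rw [Nat.card_eq_fintype_card, Nat.card_eq_fintype_card] at h1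
  have h2 : Fintype.card {v // v ≠ w} = Fintype.card W - 1 := by
    rw [Fintype.card_subtype_compl, Fintype.card_subtype_eq]
  exact h2.trans (Nat.sub_eq_of_eq_add h1.symm)

theorem parent_or_parent [Finite W] (hT : T.IsTree) {w : W} {par : W → W}
    (hpar : ∀ v, v ≠ w → T.Adj v (par v) ∧ T.dist w (par v) + 1 = T.dist w v) {x y : W}
    (h : T.Adj x y) : (x ≠ w ∧ par x = y) ∨ (y ≠ w ∧ par y = x) := by
  obtain ⟨⟨v, hv⟩, h1⟩ := (bijective_parentEdge hT hpar).2 ⟨s(x, y), h⟩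
  have h2 : s(v, par v) = s(x, y) := congrArg Subtype.val h1
  rcases Sym2.eq_iff.1 h2 with ⟨rfl, h3⟩ | ⟨rfl, h3⟩
  · exact Or.inl ⟨hv, h3⟩
  · exact Or.inr ⟨hv, h3⟩

/-- In a tree, a sequence of edges that does not turn back runs along a path. -/
theorem injOn_of_edges_ne [Finite W] (hT : T.IsTree) {d : ℕ} {p : ℕ → W}
    (hadj : ∀ i < d, T.Adj (p i) (p (i + 1)))
    (hne : ∀ i, i + 1 < d → s(p i, p (i + 1)) ≠ s(p (i + 1), p (i + 1 + 1))) :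
    Set.InjOn p {i | i ≤ d} := by
  -- With the root at the start of the sequence, a step towards the root would go back along the
  -- edge just used. So each step leads away from the root and the distance grows by one.
  obtain ⟨par, hpar⟩ := exists_parent hT.connected (p 0)
  have key : ∀ i, i < d → p (i + 1) ≠ p 0 ∧ par (p (i + 1)) = p i := by
    intro i
    induction i with
    | zero =>
      intro hi
      rcases parent_or_parent hT hpar (hadj 0 hi) with ⟨h, -⟩ | h
      · exact absurd rfl h
      · exact h
    | succ i ih =>
      intro hi
      rcases parent_or_parent hT hpar (hadj (i + 1) hi) with ⟨-, h⟩ | h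
      · exfalso
        apply hne i hi
        rw [← h, (ih (by omega)).2, Sym2.eq_swap]
      · exact h
  have hdist : ∀ i, i ≤ d → T.dist (p 0) (p i) = i := by
    intro i
    induction i with
    | zero => intro _; exact SimpleGraph.dist_self
    | succ i ih =>
      intro hi
      obtain ⟨h1, h2⟩ := key i hi
      have h3 := (hpar _ h1).2
      rw [h2, ih (by omega)] at h3
      exact h3.symm
  intro i hi i' hi' h
  rw [← hdist i hi, ← hdist i' hi', h]

variable [Fintype W] [DecidableEq W]

/-- The vertices different from `w` and from the vertices of the path `p` other than `p j`. -/
def offPath (p : ℕ → W) (d : ℕ) (w : W) (j : ℕ) : Finset W :=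
  univ.filter fun v => v ≠ w ∧ ∀ i ≤ d, i ≠ j → v ≠ p i

/-- The root takes the place of p_j. If p_j is not the root, it is counted among the vertices off
the path. -/
theorem sum_vertices {d : ℕ} {p : ℕ → W} (hp : Set.InjOn p {i | i ≤ d}) {w : W} {j : ℕ}
    (hw : ∀ i ≤ d, i ≠ j → p i ≠ w) (G : W → ℝ) :
    ∑ v, G v = G w + ∑ i ∈ (range (d + 1)).erase j, G (p i) + ∑ v ∈ offPath p d w j, G v := by
  have hmem : ∀ i, i ∈ (range (d + 1)).erase j ↔ i ≠ j ∧ i ≤ d := by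
    intro i; rw [mem_erase, mem_range, Nat.lt_succ_iff]
  have h1 : ∑ i ∈ (range (d + 1)).erase j, G (p i) =
      ∑ v ∈ ((range (d + 1)).erase j).image p, G v := by
    rw [Finset.sum_image]
    intro i hi i' hi' h
    exact hp ((hmem i).1 hi).2 ((hmem i').1 hi').2 h
  have h2 : offPath p d w j = (univ.erase w) \ ((range (d + 1)).erase j).image p := by
    ext v
    simp only [offPath, mem_filter, mem_univ, true_and, mem_sdiff, mem_erase, and_true, mem_image,
      hmem, not_exists, not_and]
    refine and_congr_right fun _ => ⟨fun h i hi hv => h i hi.2 hi.1 hv.symm, fun h i hi hij hv =>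
      h i ⟨hij, hi⟩ hv.symm⟩
  have h3 : ((range (d + 1)).erase j).image p ⊆ univ.erase w := by
    intro v hv
    obtain ⟨i, hi, rfl⟩ := mem_image.1 hv
    have := (hmem i).1 hi
    exact mem_erase.2 ⟨hw i this.2 this.1, mem_univ _⟩
  rw [h1, h2, ← Finset.add_sum_erase _ _ (mem_univ w), ← Finset.sum_sdiff h3]
  ring

/-- The edges of a tree, sorted by a path `p` and a root `w`: the edges off the path join the
vertices of `offPath p d w j` with their parents. -/
theorem exists_offPath_decomposition [Fintype T.edgeSet] (hT : T.IsTree) {d : ℕ} {p : ℕ → W}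
    (hp : Set.InjOn p {i | i ≤ d}) (hadj : ∀ i < d, T.Adj (p i) (p (i + 1))) {w : W} {par : W → W}
    (hpar : ∀ v, v ≠ w → T.Adj v (par v) ∧ T.dist w (par v) + 1 = T.dist w v) :
    ∃ j ≤ d, (∀ i ≤ d, i ≠ j → p i ≠ w) ∧ ∀ g : Sym2 W → ℝ,
      ∑ e : T.edgeSet, g e = ∑ i ∈ range d, g s(p i, p (i + 1)) +
        ∑ v ∈ offPath p d w j, g s(v, par v) := by
  -- For the i-th edge of the path, l is the index of its lower end, the one whose parent edge it
  -- is. These d distinct indices omit exactly one of 0, …, d, and this one is j.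
  have hch : ∀ i, ∃ l, i < d → l ≤ d ∧ p l ≠ w ∧ s(p l, par (p l)) = s(p i, p (i + 1)) := by
    intro i
    by_cases hi : i < d
    · rcases parent_or_parent hT hpar (hadj i hi) with ⟨h1, h2⟩ | ⟨h1, h2⟩
      · exact ⟨i, fun _ => ⟨hi.le, h1, by rw [h2]⟩⟩
      · exact ⟨i + 1, fun _ => ⟨hi, h1, by rw [h2, Sym2.eq_swap]⟩⟩
    · exact ⟨i, fun h => absurd h hi⟩
  choose ch hch using hch
  have hinj : Set.InjOn ch (range d) := by
    intro i hi i' hi' h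
    rw [coe_range, Set.mem_Iio] at hi hi'
    have h1 := (hch i hi).2.2
    rw [h, (hch i' hi').2.2] at h1
    rcases Sym2.eq_iff.1 h1 with ⟨h2, -⟩ | ⟨h2, h3⟩
    · exact (hp (show i' ≤ d by omega) (show i ≤ d by omega) h2).symm
    · have h4 := hp (show i' ≤ d by omega) (show i + 1 ≤ d by omega) h2
      have h5 := hp (show i' + 1 ≤ d by omega) (show i ≤ d by omega) h3
      omega
  have hsub : (range d).image ch ⊆ range (d + 1) := by
    intro l hl
    obtain ⟨i, hi, rfl⟩ := mem_image.1 hl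
    exact mem_range.2 (Nat.lt_succ_of_le (hch i (mem_range.1 hi)).1)
  have hcard : #(range (d + 1) \ (range d).image ch) = 1 := by
    rw [card_sdiff_of_subset hsub, card_image_of_injOn hinj, card_range, card_range]
    omega
  obtain ⟨j, hj⟩ := card_eq_one.1 hcard
  have himage : (range d).image ch = (range (d + 1)).erase j := by
    rw [← sdiff_singleton_eq_erase, ← hj, Finset.sdiff_sdiff_eq_self hsub]
  have hjd : j ≤ d := by
    have : j ∈ range (d + 1) \ (range d).image ch := hj ▸ mem_singleton_self j
    exact Nat.lt_succ_iff.1 (mem_range.1 (mem_sdiff.1 this).1)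
  have hw : ∀ i ≤ d, i ≠ j → p i ≠ w := by
    intro l hl hlj
    have : l ∈ (range d).image ch := by
      rw [himage, mem_erase, mem_range]
      exact ⟨hlj, by omega⟩
    obtain ⟨i, hi, rfl⟩ := mem_image.1 this
    exact (hch i (mem_range.1 hi)).2.1
  refine ⟨j, hjd, hw, fun g => ?_⟩
  have h1 : ∑ e : T.edgeSet, g e = ∑ v : {v // v ≠ w}, g s(v.1, par v.1) :=
    (Equiv.sum_comp (Equiv.ofBijective _ (bijective_parentEdge hT hpar))
      (fun e : T.edgeSet => g e)).symm
  have h2 : ∑ v : {v // v ≠ w}, g s(v.1, par v.1) = ∑ v ∈ univ.erase w, g s(v, par v) := by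
    rw [← Finset.sum_subtype (univ.erase w) (fun v => by simp) fun v => g s(v, par v)]
  have h3 := sum_vertices hp hw fun v => g s(v, par v)
  rw [← Finset.add_sum_erase _ _ (mem_univ w), ← himage, Finset.sum_image hinj] at h3
  have h4 : ∑ i ∈ range d, g s(p (ch i), par (p (ch i))) = ∑ i ∈ range d, g s(p i, p (i + 1)) :=
    Finset.sum_congr rfl fun i hi => by rw [(hch i (mem_range.1 hi)).2.2]
  rw [h4] at h3
  rw [h1, h2]
  linarith

/-- After a reversal of the path, the exceptional index lies in its first half. -/
theorem exists_offPath_decomposition_le_half [Fintype T.edgeSet] (hT : T.IsTree) {d : ℕ}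
    {p : ℕ → W} (hp : Set.InjOn p {i | i ≤ d}) (hadj : ∀ i < d, T.Adj (p i) (p (i + 1))) {w : W}
    {par : W → W}
    (hpar : ∀ v, v ≠ w → T.Adj v (par v) ∧ T.dist w (par v) + 1 = T.dist w v) :
    ∃ p : ℕ → W, Set.InjOn p {i | i ≤ d} ∧ (∀ i < d, T.Adj (p i) (p (i + 1))) ∧
      ∃ j ≤ d / 2, (∀ i ≤ d, i ≠ j → p i ≠ w) ∧ ∀ g : Sym2 W → ℝ,
      ∑ e : T.edgeSet, g e = ∑ i ∈ range d, g s(p i, p (i + 1)) +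
        ∑ v ∈ offPath p d w j, g s(v, par v) := by
  obtain ⟨j, hj, hw, hsum⟩ := exists_offPath_decomposition hT hp hadj hpar
  rcases le_or_gt j (d / 2) with hle | hlt
  · exact ⟨p, hp, hadj, j, hle, hw, hsum⟩
  refine ⟨fun i => p (d - i), ?_, ?_, d - j, by omega, ?_, fun g => ?_⟩
  · intro i hi i' hi' h
    have hi : i ≤ d := hi
    have hi' : i' ≤ d := hi'
    have := hp (show d - i ≤ d by omega) (show d - i' ≤ d by omega) h
    omega
  · intro i hi
    have := hadj (d - (i + 1)) (by omega)
    rw [show d - (i + 1) + 1 = d - i by omega] at this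
    exact this.symm
  · intro i hi hij
    exact hw (d - i) (by omega) (by omega)
  · rw [hsum]
    congr 1
    · rw [← Finset.sum_range_reflect]
      refine Finset.sum_congr rfl fun i hi => ?_
      rw [mem_range] at hi
      rw [show d - 1 - i = d - (i + 1) by omega, show d - (i + 1) + 1 = d - i by omega,
        Sym2.eq_swap]
    · refine Finset.sum_congr ?_ fun _ _ => rfl
      ext v
      simp only [offPath, mem_filter, mem_univ, true_and]
      refine and_congr_right fun _ => ⟨fun h i hi hij => h (d - i) (by omega) (by omega),
        fun h i hi hij => ?_⟩
      have := h (d - i) (by omega) (by omega)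
      rwa [show d - (d - i) = i by omega] at this

/-- A zero next to a positive entry could be raised with profit, since the gain is linear and the
cost quadratic; connectedness spreads positivity to all vertices. -/
theorem pos_of_isMax [Fintype T.edgeSet] (hT : T.Connected) {q c : ℝ} (hc : 0 < c) (hq : 0 < q)
    (hle : ∀ z : W → ℝ, (∀ w, 0 ≤ z w) →
      pairForm (Subtype.val : T.edgeSet → Sym2 W) c z ≤ q * ∑ w, z w ^ 2)
    {z : W → ℝ} (hz0 : z ≠ 0) (hz : ∀ w, 0 ≤ z w)
    (heq : pairForm (Subtype.val : T.edgeSet → Sym2 W) c z = q * ∑ w, z w ^ 2) (u : W) :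
    0 < z u := by
  have hstep : ∀ u v, T.Adj u v → 0 < z v → 0 < z u := by
    intro u v huv hv
    by_contra! hu
    have hu0 : z u = 0 := le_antisymm hu (hz u)
    -- With this t the cost q t² is c t z_v, half of the guaranteed gain 2c t z_v.
    set t : ℝ := c * z v / q with ht
    have ht0 : 0 < t := by positivity
    set z' := Function.update z u t with hz'
    have hmono : ∀ x, z x ≤ z' x := by
      intro x
      rcases eq_or_ne x u with rfl | hx
      · rw [hz', Function.update_self, hu0]; exact ht0.le
      · rw [hz', Function.update_of_ne hx]
    have hzu : z' u = t := Function.update_self ..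
    have hzv : z' v = z v := Function.update_of_ne huv.ne' ..
    have hpair : ∀ e : T.edgeSet, pairVal c z e +
        (if (⟨s(u, v), huv⟩ : T.edgeSet) = e then 2 * c * (t * z v) else 0) ≤ pairVal c z' e := by
      rintro ⟨e, he⟩
      split_ifs with h
      · rw [← h]
        simp only [pairVal_mk, hzu, hzv, hu0]
        nlinarith [sq_nonneg t]
      · rw [add_zero]
        induction e with | _ x y
        exact edgeVal_mono hc.le (hz x) (hz y) (hmono x) (hmono y)
    have h1 := Finset.sum_le_sum fun e (_ : e ∈ (univ : Finset T.edgeSet)) => hpair e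
    rw [Finset.sum_add_distrib, Finset.sum_ite_eq, if_pos (mem_univ _)] at h1
    have h2 := hle z' fun x => (hz x).trans (hmono x)
    have h3 : ∑ x, z' x ^ 2 = ∑ x, z x ^ 2 + t ^ 2 := by
      rw [← Finset.add_sum_erase _ _ (mem_univ u), ← Finset.add_sum_erase _ _ (mem_univ u), hzu,
        hu0, Finset.sum_congr rfl fun x hx => by
          rw [hz', Function.update_of_ne (Finset.ne_of_mem_erase hx)]]
      ring
    rw [h3] at h2
    rw [pairForm] at h2 heq
    have h4 : 2 * c * (t * z v) ≤ q * t ^ 2 := by linarith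
    have h5 : q * t = c * z v := by rw [ht]; field_simp
    have h6 : 0 < c * (t * z v) := by positivity
    nlinarith
  obtain ⟨v, hv⟩ := Function.ne_iff.1 hz0
  replace hv : 0 < z v := lt_of_le_of_ne (hz v) (Ne.symm hv)
  obtain ⟨p⟩ := hT.preconnected u v
  induction p with
  | nil => exact hv
  | cons h p ih => exact hstep _ _ h (ih hv)

end Tree

/-! ### Comparison of a tree with the broom -/

section Comparison

/-- The edges of the path `0, …, d` and of `m - d` pendent edges at the vertex `d / 2`. -/
def broomEdge (m d : ℕ) : Fin d ⊕ Fin (m - d) → Sym2 (Fin (d + 1) ⊕ Fin (m - d)) :=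
  Sum.elim (fun i => s(.inl i.castSucc, .inl i.succ))
    fun t => s(.inl ⟨d / 2, Nat.lt_succ_of_le (Nat.div_le_self d 2)⟩, .inr t)

theorem broomEdge_injective (m d : ℕ) : Function.Injective (broomEdge m d) := by
  rintro (i | t) (i' | t') h
  · simp only [broomEdge, Sum.elim_inl, Sym2.eq_iff, Sum.inl.injEq, Fin.ext_iff, Fin.val_succ,
      Fin.val_castSucc] at h
    congr 1
    ext
    omega
  · simp [broomEdge] at h
  · simp [broomEdge] at h
  · simp [broomEdge] at h
    rw [h]

theorem broomEdge_not_isDiag (m d : ℕ) (j : Fin d ⊕ Fin (m - d)) :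
    ¬ (broomEdge m d j).IsDiag := by
  rcases j with i | t
  · simp [broomEdge, Fin.ext_iff]
  · simp [broomEdge]

theorem broomBound_of_pairForm_le {m d : ℕ} {c q : ℝ}
    (hle : ∀ z : Fin (d + 1) ⊕ Fin (m - d) → ℝ, (∀ w, 0 ≤ z w) →
      pairForm (broomEdge m d) c z ≤ q * ∑ w, z w ^ 2) {B : Type*} [Fintype B]
    (e : B ≃ Fin (m - d)) : BroomBound B d c (d / 2) q := by
  intro a b ha hb
  have h := hle (Sum.elim (fun i => a i) fun t => b (e.symm t)) (by
    rintro (i | t)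
    · exact ha i
    · exact hb _)
  rw [pairForm, Fintype.sum_sum_type, Fintype.sum_sum_type] at h
  simp only [broomEdge, Sum.elim_inl, Sum.elim_inr, pairVal_mk, Fin.val_castSucc,
    Fin.val_succ] at h
  rw [Fin.sum_univ_eq_sum_range (fun i => a i ^ 2 + a (i + 1) ^ 2 + 2 * c * (a i * a (i + 1))),
    Fin.sum_univ_eq_sum_range (fun i => a i ^ 2),
    Equiv.sum_comp e.symm fun t => b t ^ 2,
    Equiv.sum_comp e.symm fun t => a (d / 2) ^ 2 + b t ^ 2 + 2 * c * (a (d / 2) * b t)] at h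
  refine (Eq.le ?_).trans h
  rw [broomForm]
  congr 1
  exact Finset.sum_congr rfl fun t _ => by unfold edgeVal; ring

variable {W : Type*} [Fintype W] [DecidableEq W] {T : SimpleGraph W} [Fintype T.edgeSet]

/-- If the form of a tree with a path of length `d` reaches a bound for the form of the broom with
the same number of edges, then the tree is the broom. -/
theorem exists_equiv_broom (hT : T.IsTree) {m d : ℕ} (hd : 3 ≤ d) (hm : d < m)
    (hcard : Fintype.card T.edgeSet = m) {p : ℕ → W} (hp : Set.InjOn p {i | i ≤ d})
    (hadj : ∀ i < d, T.Adj (p i) (p (i + 1))) {q c : ℝ} (hq : 0 < q) (hc0 : 0 < c) (hc1 : c ≤ 1)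
    (hle : ∀ z : W → ℝ, (∀ w, 0 ≤ z w) →
      pairForm (Subtype.val : T.edgeSet → Sym2 W) c z ≤ q * ∑ w, z w ^ 2)
    {z : W → ℝ} (hz0 : z ≠ 0) (hz : ∀ w, 0 ≤ z w)
    (heq : pairForm (Subtype.val : T.edgeSet → Sym2 W) c z = q * ∑ w, z w ^ 2)
    (hbroom : ∀ z : Fin (d + 1) ⊕ Fin (m - d) → ℝ, (∀ w, 0 ≤ z w) →
      pairForm (broomEdge m d) c z ≤ q * ∑ w, z w ^ 2) :
    ∃ (α : Fin (d + 1) ⊕ Fin (m - d) ≃ W) (β : Fin d ⊕ Fin (m - d) ≃ T.edgeSet),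
      ∀ j, (β j : Sym2 W) = (broomEdge m d j).map α := by
  have hpos := pos_of_isMax hT.connected hc0 hq hle hz0 hz heq
  have := hT.connected.nonempty
  obtain ⟨w, hwmax⟩ := Finite.exists_max z
  obtain ⟨par, hpar⟩ := exists_parent hT.connected w
  obtain ⟨p, hp, hadj, j, hj, hw, hsum⟩ :=
    exists_offPath_decomposition_le_half hT hp hadj hpar
  have hV := (SimpleGraph.isTree_iff_connected_and_card.1 hT).2
  rw [Nat.card_eq_fintype_card, Nat.card_eq_fintype_card, hcard] at hV
  have hjmem : j ∈ range (d + 1) := mem_range.2 (by omega)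
  have hB : #(offPath p d w j) = m - d := by
    have h1 := sum_vertices hp hw fun _ => (1 : ℝ)
    simp only [sum_const, nsmul_eq_mul, mul_one, card_univ, card_erase_of_mem hjmem, card_range,
      Nat.add_sub_cancel] at h1
    have h2 : Fintype.card W = 1 + d + #(offPath p d w j) := by exact_mod_cast h1
    omega
  set B := {v // v ∈ offPath p d w j} with hBdef
  have hBcard : Fintype.card B = Fintype.card (Fin (m - d)) := by
    rw [Fintype.card_coe, hB, Fintype.card_fin]
  have eB : B ≃ Fin (m - d) := Fintype.equivOfCardEq hBcard
  have : Nonempty B := ⟨eB.symm ⟨0, by omega⟩⟩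
  -- The largest value is placed at the exceptional index j, and the parent of every vertex off the
  -- path is replaced by that place. The values at the ends of each edge can only increase.
  set a : ℕ → ℝ := fun i => if i = j then z w else z (p i) with ha
  set b : B → ℝ := fun t => z t.1 with hb
  have haj : a j = z w := if_pos rfl
  have hane : ∀ i, i ≠ j → a i = z (p i) := fun i hi => if_neg hi
  have hzpa : ∀ i, z (p i) ≤ a i := by
    intro i
    rcases eq_or_ne i j with rfl | hi
    · rw [haj]; exact hwmax _
    · rw [hane i hi]
  obtain ⟨hbd, htight⟩ := broomForm_le hd hc0 hc1 (broomBound_of_pairForm_le hbroom eB)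
    (d / 2 - j) j a b (by omega)
    (fun i => (hpos _).trans_le (hzpa i)) (fun t => hpos _)
    (fun i _ => by rw [haj, ha]; dsimp only; split_ifs; exacts [le_rfl, hwmax _])
    (fun t => by rw [haj]; exact hwmax _)
  have hsq : ∑ v, z v ^ 2 = broomSq d a b := by
    rw [sum_vertices hp hw, broomSq, ← Finset.add_sum_erase _ _ hjmem, haj,
      ← Finset.sum_coe_sort (offPath p d w j)]
    congr 2
    exact Finset.sum_congr rfl fun i hi => by rw [hane i (Finset.ne_of_mem_erase hi)]
  have hform : pairForm (Subtype.val : T.edgeSet → Sym2 W) c z =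
      ∑ i ∈ range d, edgeVal c (z (p i)) (z (p (i + 1))) +
        ∑ t : B, edgeVal c (z t.1) (z (par t.1)) := by
    rw [pairForm, hsum (pairVal c z), ← Finset.sum_coe_sort (offPath p d w j)]
    rfl
  have hle1 : ∀ i ∈ range d, edgeVal c (z (p i)) (z (p (i + 1))) ≤ edgeVal c (a i) (a (i + 1)) :=
    fun i _ => edgeVal_mono hc0.le (hz _) (hz _) (hzpa i) (hzpa (i + 1))
  have hle2 : ∀ t ∈ (univ : Finset B),
      edgeVal c (z t.1) (z (par t.1)) ≤ edgeVal c (b t) (a j) :=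
    fun t _ => edgeVal_mono hc0.le (hz _) (hz _) le_rfl (by rw [haj]; exact hwmax _)
  have hs1 := Finset.sum_le_sum hle1
  have hs2 := Finset.sum_le_sum hle2
  rw [hsq] at heq
  have hbf : broomForm d c j a b = q * broomSq d a b := by
    refine le_antisymm hbd ?_
    rw [← heq, hform, broomForm]
    linarith
  rw [hform] at heq
  rw [broomForm] at hbf
  obtain ⟨hj0, hastrict, hbstrict⟩ := htight (by rw [broomForm]; exact hbf)
  have hj : j = d / 2 := by omega
  -- The total is not increased by the replacement, so no single edge term is. By the strict maximum
  -- at `w` no vertex other than `w` can have been replaced.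
  have heq1 := (Finset.sum_eq_sum_iff_of_le hle1).1 (by linarith)
  have heq2 := (Finset.sum_eq_sum_iff_of_le hle2).1 (by linarith)
  have hzlt : ∀ v, v ≠ w → z v < z w := by
    intro v hv
    by_cases hvB : v ∈ offPath p d w j
    · have := hbstrict ⟨v, hvB⟩
      rwa [haj] at this
    · simp only [offPath, mem_filter, mem_univ, true_and, not_and, not_forall, not_not] at hvB
      obtain ⟨i, hi, hij, rfl⟩ := hvB hv
      have := hastrict i hi hij
      rwa [haj, hane i hij] at this
  -- The path edge from j to j + 1, which exists because j = d / 2 < d, shows that the value at p_j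
  -- was already maximal.
  have hpj : p j = w := by
    by_contra hne
    have h1 := hzlt _ hne
    have h2 := (eq_of_edgeVal_le hc0.le (hz _) (hz _) (hzpa j) (hzpa (j + 1))
      (heq1 j (mem_range.2 (by omega))).ge).1
    rw [haj] at h2
    linarith
  have hparw : ∀ v ∈ offPath p d w j, par v = w := by
    intro v hv
    by_contra hne
    have h1 := hzlt _ hne
    have h2 := (eq_of_edgeVal_le hc0.le (hz _) (hz _) le_rfl
      (by rw [haj]; exact hwmax _) (heq2 ⟨v, hv⟩ (mem_univ _)).ge).2
    rw [haj] at h2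
    linarith
  have hoff : ∀ v ∈ offPath p d w j, v ≠ w ∧ ∀ i ≤ d, v ≠ p i := by
    intro v hv
    have h1 := (mem_filter.1 hv).2
    refine ⟨h1.1, fun i hi => ?_⟩
    rcases eq_or_ne i j with rfl | hij
    · rw [hpj]; exact h1.1
    · exact h1.2 i hi hij
  have hαinj : Function.Injective
      (Sum.elim (fun i => p i) fun t => (eB.symm t).1 : Fin (d + 1) ⊕ Fin (m - d) → W) := by
    rintro (i | t) (i' | t') h
    · exact congrArg Sum.inl (Fin.ext (hp (Nat.lt_succ_iff.1 i.2) (Nat.lt_succ_iff.1 i'.2) h))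
    · exact absurd h.symm ((hoff _ (eB.symm t').2).2 i (Nat.lt_succ_iff.1 i.2))
    · exact absurd h ((hoff _ (eB.symm t).2).2 i' (Nat.lt_succ_iff.1 i'.2))
    · exact congrArg Sum.inr (eB.symm.injective (Subtype.ext h))
  let α : Fin (d + 1) ⊕ Fin (m - d) ≃ W := Equiv.ofBijective _
    ((Fintype.bijective_iff_injective_and_card _).2 ⟨hαinj, by simp; omega⟩)
  have hmem : ∀ j, (broomEdge m d j).map α ∈ T.edgeSet := by
    rintro (i | t)
    · exact hadj i i.2
    · have h1 := (hpar _ (hoff _ (eB.symm t).2).1).1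
      rw [hparw _ (eB.symm t).2] at h1
      have h2 : T.Adj (p (d / 2)) (eB.symm t).1 := by rw [← hj, hpj]; exact h1.symm
      exact h2
  have hβinj : Function.Injective fun j => (⟨(broomEdge m d j).map α, hmem j⟩ : T.edgeSet) := by
    intro i i' h
    exact broomEdge_injective m d (Sym2.map.injective α.injective (congrArg Subtype.val h))
  exact ⟨α, Equiv.ofBijective _ ((Fintype.bijective_iff_injective_and_card _).2
    ⟨hβinj, by simp [hcard]; omega⟩), fun _ => rfl⟩

end Comparison

end Hypergraph

/-! ### Powers of graphs and S₁ as indexed edge families -/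

namespace Hypergraph

open Finset

section Representations

theorem represents_of_equiv {α ι J : Type*} {G : Hypergraph α} {E : J → Finset ι}
    (hE : Function.Injective E) (hV : G.vertexSet = Set.univ) (e : α ≃ ι)
    (he : ∀ X : Set α, X ∈ G.edgeSet ↔ ∃ j, ∀ x, x ∈ X ↔ e x ∈ E j) : G.Represents E := by
  let φ : G.vertexSet ≃ ι := ((Equiv.setCongr hV).trans (Equiv.Set.univ α)).trans e
  refine ⟨hE, φ, fun s => ?_⟩
  rw [he]
  refine exists_congr fun j => ?_
  have hφ : ∀ v : G.vertexSet, φ v = e v := fun _ => rfl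
  have h1 : φ '' s = e '' (Subtype.val '' s) := by
    rw [Set.image_image]; rfl
  rw [h1]
  constructor
  · intro h
    ext y
    rw [e.image_eq_preimage_symm, Set.mem_preimage, h, e.apply_symm_apply, Finset.mem_coe]
  · intro h x
    rw [← Finset.mem_coe, ← h, e.injective.mem_set_image]

theorem mem_powerEdge_inl {W J : Type*} [DecidableEq W] {n : ℕ} {ε : J → Sym2 W} {j : J} {w : W} :
    (.inl w : W ⊕ (J × Fin n)) ∈ powerEdge n ε j ↔ w ∈ ε j := by
  rw [powerEdge, inl_mem_disjSum, Sym2.mem_toFinset]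

theorem mem_powerEdge_inr {W J : Type*} [DecidableEq W] {n : ℕ} {ε : J → Sym2 W} {j : J}
    {p : J × Fin n} : (.inr p : W ⊕ (J × Fin n)) ∈ powerEdge n ε j ↔ p.1 = j := by
  rw [powerEdge, inr_mem_disjSum, mem_product, mem_singleton]
  simp

theorem graphPower_represents {W : Type*} [DecidableEq W] (T : SimpleGraph W) {k : ℕ}
    (hk : 3 ≤ k) :
    (graphPower T k).Represents (powerEdge (k - 2) (Subtype.val : T.edgeSet → Sym2 W)) := by
  refine represents_of_equiv (powerEdge_injective (by omega) _) rfl (Equiv.refl _) fun X => ?_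
  refine exists_congr fun e => ?_
  rw [eq_comm, Set.ext_iff]
  refine forall_congr' fun x => iff_congr Iff.rfl ?_
  rcases x with w | ⟨e', l⟩
  · simp [mem_powerEdge_inl]
  · simp [mem_powerEdge_inr, eq_comm]

theorem Represents.reindex_powerEdge {α W W' J J' : Type*} [DecidableEq W] [DecidableEq W']
    {G : Hypergraph α} {n : ℕ} (hn : 0 < n) {ε : J → Sym2 W} {ε' : J' → Sym2 W'}
    (h : G.Represents (powerEdge n ε)) (a : W ≃ W') (b : J ≃ J')
    (hab : ∀ j, ε' (b j) = (ε j).map a) : G.Represents (powerEdge n ε') := by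
  refine h.reindex (powerEdge_injective hn _)
    (Equiv.sumCongr a (Equiv.prodCongr b (Equiv.refl _))) b fun j => ?_
  ext y
  rw [Equiv.image_eq_preimage_symm, Set.mem_preimage, Finset.mem_coe, Finset.mem_coe]
  rcases y with w | ⟨j', l⟩
  · rw [mem_powerEdge_inl, hab, Sym2.mem_map]
    simp only [Equiv.sumCongr_symm, Equiv.sumCongr_apply, Sum.map_inl, mem_powerEdge_inl]
    constructor
    · rintro ⟨v, hv, rfl⟩; simpa using hv
    · intro hv; exact ⟨_, hv, by simp⟩
  · rw [mem_powerEdge_inr]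
    simp only [Equiv.sumCongr_symm, Equiv.sumCongr_apply, Sum.map_inr, mem_powerEdge_inr]
    simp [Equiv.symm_apply_eq]

/-- One of the `n + 1` new vertices of each attached edge becomes a vertex of the broom. -/
def brushEquiv (m d n : ℕ) :
    (Fin (d + 1) ⊕ ((Fin d × Fin n) ⊕ (Fin (m - d) × Fin (n + 1)))) ≃
      (Fin (d + 1) ⊕ Fin (m - d)) ⊕ ((Fin d ⊕ Fin (m - d)) × Fin n) where
  toFun
    | .inl i => .inl (.inl i)
    | .inr (.inl (i, l)) => .inr (.inl i, l)
    | .inr (.inr (t, l)) => Fin.cases (.inl (.inr t)) (fun l => .inr (.inr t, l)) l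
  invFun
    | .inl (.inl i) => .inl i
    | .inl (.inr t) => .inr (.inr (t, 0))
    | .inr (.inl i, l) => .inr (.inl (i, l))
    | .inr (.inr t, l) => .inr (.inr (t, l.succ))
  left_inv := by
    rintro (i | ⟨i, l⟩ | ⟨t, l⟩)
    · rfl
    · rfl
    · cases l using Fin.cases <;> rfl
  right_inv := by
    rintro ((i | t) | ⟨i | t, l⟩) <;> rfl

theorem S1_represents (m d : ℕ) {k : ℕ} (hk : 3 ≤ k) :
    (S1 m d k).Represents (powerEdge (k - 2) (broomEdge m d)) := by
  obtain ⟨n, rfl⟩ : ∃ n, k = n + 3 := ⟨k - 3, by omega⟩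
  have hpath : ∀ i x, x ∈ S1PathEdge m d (n + 3) i ↔
      brushEquiv m d (n + 1) x ∈ powerEdge (n + 1) (broomEdge m d) (.inl i) := by
    intro i x
    rcases x with i' | ⟨i', l⟩ | ⟨t, l⟩
    · simp [S1PathEdge, brushEquiv, mem_powerEdge_inl, broomEdge]
    · simp [S1PathEdge, brushEquiv, mem_powerEdge_inr, eq_comm]
    · cases l using Fin.cases
      · simp [S1PathEdge, brushEquiv, mem_powerEdge_inl, broomEdge]
      · simp [S1PathEdge, brushEquiv, mem_powerEdge_inr]
  have hatt : ∀ t x, x ∈ S1AttachedEdge m d (n + 3) t ↔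
      brushEquiv m d (n + 1) x ∈ powerEdge (n + 1) (broomEdge m d) (.inr t) := by
    intro t x
    rcases x with i' | ⟨i', l⟩ | ⟨t', l⟩
    · simp [S1AttachedEdge, brushEquiv, mem_powerEdge_inl, broomEdge]
    · simp [S1AttachedEdge, brushEquiv, mem_powerEdge_inr]
    · cases l using Fin.cases
      · simp [S1AttachedEdge, brushEquiv, mem_powerEdge_inl, broomEdge, eq_comm]
      · simp [S1AttachedEdge, brushEquiv, mem_powerEdge_inr, eq_comm]
  refine represents_of_equiv (powerEdge_injective (by omega) _) rfl (brushEquiv m d (n + 1))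
    fun X => ?_
  rw [Sum.exists]
  refine or_congr (exists_congr fun i => ?_) (exists_congr fun t => ?_)
  · rw [eq_comm, Set.ext_iff]
    exact forall_congr' fun x => iff_congr Iff.rfl (hpath i x)
  · rw [eq_comm, Set.ext_iff]
    exact forall_congr' fun x => iff_congr Iff.rfl (hatt t x)

end Representations

/-! ### S₁ as a hypertree, and tree paths underlying hypergraph paths -/

section Hypertree

theorem isTree_broom {m d : ℕ} {W : Type*} (a : Fin (d + 1) ⊕ Fin (m - d) ≃ W) :
    (SimpleGraph.fromEdgeSet (Set.range fun j => (broomEdge m d j).map a)).IsTree ∧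
    (SimpleGraph.fromEdgeSet (Set.range fun j => (broomEdge m d j).map a)).edgeSet =
      Set.range fun j => (broomEdge m d j).map a := by
  set ε := fun j => (broomEdge m d j).map a with hε
  have hinj : Function.Injective ε := fun j j' h =>
    broomEdge_injective m d (Sym2.map.injective a.injective h)
  have hdiag : ∀ j, ¬ (ε j).IsDiag := by
    intro j h
    rw [hε, Sym2.isDiag_map a.injective] at h
    exact broomEdge_not_isDiag m d j h
  have hedge : (SimpleGraph.fromEdgeSet (Set.range ε)).edgeSet = Set.range ε := by
    rw [SimpleGraph.edgeSet_fromEdgeSet, sdiff_eq_left, Set.disjoint_left]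
    rintro _ ⟨j, rfl⟩ h
    exact hdiag j (by simpa using h)
  refine ⟨?_, hedge⟩
  have : Finite W := Finite.of_equiv _ a
  have hadj : ∀ j u v, broomEdge m d j = s(u, v) →
      (SimpleGraph.fromEdgeSet (Set.range ε)).Adj (a u) (a v) := by
    intro j u v h
    rw [← SimpleGraph.mem_edgeSet, hedge]
    exact ⟨j, by simp [hε, h]⟩
  have hreach : ∀ i, ∀ hi : i < d + 1,
      (SimpleGraph.fromEdgeSet (Set.range ε)).Reachable (a (.inl 0)) (a (.inl ⟨i, hi⟩)) := by
    intro i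
    induction i with
    | zero => intro hi; rfl
    | succ i ih =>
      intro hi
      exact (ih (by omega)).trans (hadj (.inl ⟨i, by omega⟩) _ _ rfl).reachable
  rw [SimpleGraph.isTree_iff_connected_and_card, hedge]
  constructor
  · have : Nonempty W := ⟨a (.inl 0)⟩
    refine SimpleGraph.connected_iff_exists_forall_reachable _ |>.2 ⟨a (.inl 0), fun v => ?_⟩
    obtain ⟨v, rfl⟩ := a.surjective v
    rcases v with i | t
    · exact hreach i i.2
    · exact (hreach _ _).trans (hadj (.inr t) _ _ rfl).reachable
  · rw [← Nat.card_congr (Equiv.ofInjective ε hinj), ← Nat.card_congr a]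
    simp
    omega

theorem S1_isHypertree {m d k : ℕ} (hk : 3 ≤ k) (hm : d ≤ m) : (S1 m d k).IsHypertree k := by
  have a : Fin (d + 1) ⊕ Fin (m - d) ≃ Fin (m + 1) :=
    Fintype.equivFinOfCardEq (by simp; omega)
  obtain ⟨h1, h2⟩ := isTree_broom a
  refine ⟨m + 1, _, h1, ?_⟩
  have hinj : Function.Injective fun j => (broomEdge m d j).map a := fun j j' h =>
    broomEdge_injective m d (Sym2.map.injective a.injective h)
  exact ((S1_represents m d hk).reindex_powerEdge (by omega) a
    ((Equiv.ofInjective _ hinj).trans (Equiv.setCongr h2.symm)) fun _ => rfl).isomorphic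
    (graphPower_represents _ hk)

/-- The vertices shared by consecutive edges determine the path, except for its two ends, which are
the other ends x and y of the first and the last edge. -/
theorem exists_path_of_edges {W : Type*} {d : ℕ} (hd : 2 ≤ d) {e : ℕ → Sym2 W} {w : ℕ → W}
    (hw : ∀ i, i + 1 < d → w (i + 1) ∈ e i ∧ w (i + 1) ∈ e (i + 1))
    (hne : ∀ i, i + 2 < d → w (i + 1) ≠ w (i + 2)) :
    ∃ p : ℕ → W, ∀ i < d, s(p i, p (i + 1)) = e i := by
  obtain ⟨x, hx⟩ := Sym2.mem_iff_exists.1 (hw 0 (by omega)).1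
  have hlast := (hw (d - 2) (by omega)).2
  rw [show d - 2 + 1 = d - 1 by omega] at hlast
  obtain ⟨y, hy⟩ := Sym2.mem_iff_exists.1 hlast
  refine ⟨fun i => if i = 0 then x else if i = d then y else w i, fun i hi => ?_⟩
  dsimp only
  rcases Nat.eq_zero_or_pos i with rfl | hi0
  · rw [if_pos rfl, if_neg (by omega), if_neg (by omega), hx, Sym2.eq_swap]
  · rw [if_neg (by omega), if_neg (by omega), if_neg (by omega)]
    obtain ⟨i, rfl⟩ : ∃ l, i = l + 1 := ⟨i - 1, by omega⟩
    split_ifs with h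
    · rw [show i + 1 = d - 1 by omega, hy]
    · exact ((Sym2.mem_and_mem_iff (hne i (by omega))).1
        ⟨(hw i hi).2, (hw (i + 1) (by omega)).1⟩).symm

/-- An interior vertex of a path lies in two distinct edges. A new vertex of the power lies in only
one, so the interior vertices are vertices of the tree and successive tree edges meet in them. -/
theorem exists_path_of_hasPath {α W : Type*} [Fintype W] [DecidableEq W] {T : SimpleGraph W}
    (hT : T.IsTree) {G : Hypergraph α} {n : ℕ}
    (hG : G.Represents (powerEdge n (Subtype.val : T.edgeSet → Sym2 W))) {u v : α} {d : ℕ}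
    (hd : 2 ≤ d) (h : G.HasPath u v d) :
    ∃ p : ℕ → W, Set.InjOn p {i | i ≤ d} ∧ ∀ i < d, T.Adj (p i) (p (i + 1)) := by
  obtain ⟨hE, φ, hφ⟩ := hG
  obtain ⟨x, e, hx, he, hxV, heE, hinc, -, -⟩ := h
  rw [edgeSet_eq_range hφ] at heE
  choose f hf using heE
  have hmem : ∀ i l, x i ∈ e l → φ ⟨x i, hxV i⟩ ∈ powerEdge n Subtype.val (f l) := by
    intro i l h
    rw [← hf l] at h
    obtain ⟨_, ⟨y, hy, rfl⟩, h2⟩ := h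
    have h3 : φ.symm y = ⟨x i, hxV i⟩ := Subtype.ext h2
    rw [← h3, φ.apply_symm_apply]
    exact hy
  have hfinj : Function.Injective f := fun i i' h => he (by rw [← hf i, ← hf i', h])
  have hshare : ∀ i, ∃ w, ∀ h : i + 1 < d, φ ⟨x ⟨i + 1, by omega⟩, hxV _⟩ = .inl w ∧
      w ∈ (f ⟨i, by omega⟩).1 ∧ w ∈ (f ⟨i + 1, h⟩).1 := by
    have : Nonempty W := hT.connected.nonempty
    intro i
    by_cases hi : i + 1 < d
    · have h1 := hmem ⟨i + 1, by omega⟩ ⟨i, by omega⟩ (hinc ⟨i, by omega⟩).2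
      have h2 := hmem ⟨i + 1, by omega⟩ ⟨i + 1, hi⟩ (hinc ⟨i + 1, hi⟩).1
      rcases hy : φ ⟨x ⟨i + 1, by omega⟩, hxV _⟩ with w | p
      · rw [hy, mem_powerEdge_inl] at h1 h2
        exact ⟨w, fun _ => ⟨hy, h1, h2⟩⟩
      · rw [hy, mem_powerEdge_inr] at h1 h2
        have := hfinj (h1.symm.trans h2)
        simp at this
    · exact ⟨Classical.arbitrary W, fun h => absurd h hi⟩
  choose w hw using hshare
  -- The tree vertex `w i` stems from the path vertex with index i + 1, hence the shift by one; the
  -- value of `e` beyond d is a mere default.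
  obtain ⟨p, hp⟩ := exists_path_of_edges hd (w := fun i => w (i - 1))
    (e := fun i => if h : i < d then (f ⟨i, h⟩).1 else s(w 0, w 0)) (by
      intro i hi
      rw [dif_pos (by omega), dif_pos hi]
      exact (hw i hi).2) (by
      intro i hi h
      have h1 := (hw i (by omega)).1
      have h2 := (hw (i + 1) (by omega)).1
      have h3 : w i = w (i + 1) := h
      rw [h3, ← h2] at h1
      have h4 := hx (congrArg Subtype.val (φ.injective h1))
      simp at h4)
  have hp' : ∀ i, ∀ hi : i < d, s(p i, p (i + 1)) = (f ⟨i, hi⟩).1 := fun i hi => by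
    rw [hp i hi, dif_pos hi]
  have hadj : ∀ i < d, T.Adj (p i) (p (i + 1)) := by
    intro i hi
    rw [← SimpleGraph.mem_edgeSet, hp' i hi]
    exact (f ⟨i, hi⟩).2
  refine ⟨p, injOn_of_edges_ne hT hadj fun i hi h => ?_, hadj⟩
  rw [hp' i (by omega), hp' (i + 1) hi] at h
  have := hfinj (Subtype.ext h)
  simp at this

end Hypertree

/-! ### The diameter of S₁ -/

section Diameter

theorem hasPath_pathDist {α : Type*} {G : Hypergraph α} {u v : α} (h : ∃ l, G.HasPath u v l) :
    G.HasPath u v (G.pathDist u v) :=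
  Nat.sInf_mem (s := {l | G.HasPath u v l}) h

/-- The graph in which two vertices are adjacent if they lie in a common edge. -/
def cliqueGraph {α : Type*} (G : Hypergraph α) : SimpleGraph α where
  Adj u v := u ≠ v ∧ ∃ e ∈ G.edgeSet, u ∈ e ∧ v ∈ e
  symm := ⟨fun _ _ ⟨h, e, he, hu, hv⟩ => ⟨h.symm, e, he, hv, hu⟩⟩
  loopless := ⟨fun _ h => h.1 rfl⟩

theorem exists_geodesic {α : Type*} {C : SimpleGraph α} (hC : C.Connected) (u : α) (l : ℕ) :
    ∀ v, C.dist u v = l → ∃ x : ℕ → α, x 0 = u ∧ x l = v ∧ (∀ i ≤ l, C.dist u (x i) = i) ∧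
      ∀ i < l, C.Adj (x i) (x (i + 1)) := by
  obtain ⟨par, hpar⟩ := exists_parent hC u
  induction l with
  | zero =>
    intro v hv
    have huv : u = v := hC.dist_eq_zero_iff.1 hv
    exact ⟨fun _ => u, rfl, huv, fun i hi => by
      rw [Nat.le_zero.1 hi]; exact SimpleGraph.dist_self, fun i hi => absurd hi (by omega)⟩
  | succ l ih =>
    intro v hv
    have hvu : v ≠ u := by
      rintro rfl
      rw [SimpleGraph.dist_self] at hv
      omega
    obtain ⟨h1, h2⟩ := hpar v hvu
    obtain ⟨x, hx0, hxl, hdist, hadj⟩ := ih (par v) (by omega)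
    refine ⟨Function.update x (l + 1) v, ?_, Function.update_self .., ?_, ?_⟩
    · rw [Function.update_of_ne (by omega), hx0]
    · intro i hi
      rcases eq_or_ne i (l + 1) with rfl | hne
      · rw [Function.update_self, hv]
      · rw [Function.update_of_ne hne, hdist i (by omega)]
    · intro i hi
      rw [Function.update_of_ne (show i ≠ l + 1 by omega)]
      rcases eq_or_ne i l with rfl | hne
      · rw [Function.update_self, hxl]
        exact h1.symm
      · rw [Function.update_of_ne (by omega)]
        exact hadj i (by omega)

/-- A geodesic of the clique graph is a path of the hypergraph: its vertices have distinct distances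
from u, and an edge used twice would contain two vertices whose distances from u differ by more than
one. -/
theorem hasPath_dist {α : Type*} {G : Hypergraph α} (hV : G.vertexSet = Set.univ)
    (hC : G.cliqueGraph.Connected) (u v : α) : G.HasPath u v (G.cliqueGraph.dist u v) := by
  obtain ⟨x, hx0, hxl, hdist, hadj⟩ := exists_geodesic hC u _ v rfl
  set l := G.cliqueGraph.dist u v
  have hedge : ∀ i : Fin l, ∃ e ∈ G.edgeSet, x i ∈ e ∧ x (i + 1) ∈ e := fun i => (hadj i i.2).2
  choose e heE he using hedge
  have hlip : ∀ y z : α, ∀ f ∈ G.edgeSet, y ∈ f → z ∈ f →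
      G.cliqueGraph.dist u z ≤ G.cliqueGraph.dist u y + 1 := by
    intro y z f hf hy hz
    rcases eq_or_ne y z with rfl | hne
    · omega
    · have h1 : G.cliqueGraph.dist y z = 1 := SimpleGraph.dist_eq_one_iff_adj.2 ⟨hne, f, hf, hy, hz⟩
      have h2 := hC.dist_triangle (u := u) (v := y) (w := z)
      omega
  have hne : ∀ i i' : Fin l, i < i' → e i ≠ e i' := by
    intro i i' hlt h
    have h1 := hlip (x i) (x (i' + 1)) (e i) (heE i) (he i).1 (h ▸ (he i').2)
    rw [hdist i i.2.le, hdist (i' + 1) i'.2] at h1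
    have : (i : ℕ) < i' := hlt
    omega
  refine ⟨fun i => x i, e, ?_, ?_, fun i => by rw [hV]; trivial, heE, he, hx0, hxl⟩
  · intro i i' h
    have h : x i = x i' := h
    have h1 := hdist i (Nat.lt_succ_iff.1 i.2)
    rw [h, hdist i' (Nat.lt_succ_iff.1 i'.2)] at h1
    exact Fin.ext h1.symm
  · intro i i' h
    rcases lt_trichotomy i i' with hlt | rfl | hlt
    · exact absurd h (hne i i' hlt)
    · rfl
    · exact absurd h.symm (hne i' i hlt)

/-- This yields the lower bound for the diameter: an integer function that rises by at most one
within an edge bounds path lengths from below. -/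
theorem HasPath.le_of_lipschitz {α : Type*} {G : Hypergraph α} {h : α → ℕ}
    (hh : ∀ e ∈ G.edgeSet, ∀ x ∈ e, ∀ y ∈ e, h y ≤ h x + 1) {u v : α} {l : ℕ}
    (hp : G.HasPath u v l) : h v ≤ h u + l := by
  obtain ⟨x, e, -, -, -, he, hinc, rfl, rfl⟩ := hp
  have key : ∀ i, ∀ hi : i < l + 1, h (x ⟨i, hi⟩) ≤ h (x 0) + i := by
    intro i
    induction i with
    | zero => intro _; exact le_rfl
    | succ i ih =>
      intro hi
      have h1 := ih (by omega)
      have h2 := hh _ (he ⟨i, by omega⟩) _ (hinc ⟨i, by omega⟩).1 _ (hinc ⟨i, by omega⟩).2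
      have h3 : h (x ⟨i + 1, hi⟩) ≤ h (x ⟨i, by omega⟩) + 1 := h2
      omega
  exact key l (by omega)

variable {m d k : ℕ}

/-- The smallest index of a path vertex that lies in an edge with the given vertex. -/
def S1Low : S1Vertex m d k → ℕ
  | .inl i => i
  | .inr (.inl (i, _)) => i
  | .inr (.inr _) => d / 2

/-- The largest index of a path vertex that is the given vertex, or lies in its only edge. -/
def S1High : S1Vertex m d k → ℕ
  | .inl i => i
  | .inr (.inl (i, _)) => i + 1
  | .inr (.inr _) => d / 2

/-- The distance to the path. -/
def S1Height : S1Vertex m d k → ℕ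
  | .inl _ => 0
  | .inr _ => 1

theorem S1Low_lipschitz : ∀ e ∈ (S1 m d k).edgeSet, ∀ x ∈ e, ∀ y ∈ e, S1Low y ≤ S1Low x + 1 := by
  have h1 : ∀ i, ∀ x ∈ S1PathEdge m d k i, (i : ℕ) ≤ S1Low x ∧ S1Low x ≤ i + 1 := by
    rintro i x ((rfl | rfl) | ⟨j, rfl⟩) <;> simp [S1Low]
  have h2 : ∀ t, ∀ x ∈ S1AttachedEdge m d k t, S1Low x = d / 2 := by
    rintro t x (rfl | ⟨j, rfl⟩) <;> simp [S1Low]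
  rintro e (⟨i, rfl⟩ | ⟨t, rfl⟩) x hx y hy
  · have := h1 i x hx
    have := h1 i y hy
    omega
  · rw [h2 t x hx, h2 t y hy]
    omega

/-- There is a walk of length at most `n` in the clique graph. -/
def WalkLE {α : Type*} (C : SimpleGraph α) (n : ℕ) (u v : α) : Prop :=
  ∃ p : C.Walk u v, p.length ≤ n

theorem WalkLE.symm {α : Type*} {C : SimpleGraph α} {n : ℕ} {u v : α} (h : WalkLE C n u v) :
    WalkLE C n v u := by
  obtain ⟨p, hp⟩ := h
  exact ⟨p.reverse, by rwa [SimpleGraph.Walk.length_reverse]⟩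

theorem WalkLE.trans {α : Type*} {C : SimpleGraph α} {n n' : ℕ} {u v w : α}
    (h : WalkLE C n u v) (h' : WalkLE C n' v w) : WalkLE C (n + n') u w := by
  obtain ⟨p, hp⟩ := h
  obtain ⟨p', hp'⟩ := h'
  exact ⟨p.append p', by rw [SimpleGraph.Walk.length_append]; omega⟩

theorem WalkLE.mono {α : Type*} {C : SimpleGraph α} {n n' : ℕ} {u v : α}
    (h : WalkLE C n u v) (hn : n ≤ n') : WalkLE C n' u v := by
  obtain ⟨p, hp⟩ := h
  exact ⟨p, hp.trans hn⟩

theorem walkLE_one {α : Type*} {G : Hypergraph α} {e : Set α} (he : e ∈ G.edgeSet) {u v : α}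
    (hu : u ∈ e) (hv : v ∈ e) : WalkLE G.cliqueGraph 1 u v := by
  by_cases h : u = v
  · subst h
    exact ⟨.nil, by simp⟩
  · have hadj : G.cliqueGraph.Adj u v := ⟨h, e, he, hu, hv⟩
    exact ⟨.cons hadj .nil, by simp⟩

theorem S1_walkLE_path (i l : ℕ) (h : i + l < d + 1) :
    WalkLE (S1 m d k).cliqueGraph l (.inl ⟨i, by omega⟩) (.inl ⟨i + l, h⟩) := by
  induction l with
  | zero => exact ⟨.nil, by simp⟩
  | succ l ih =>
    have h1 := walkLE_one (G := S1 m d k) (e := S1PathEdge m d k ⟨i + l, by omega⟩)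
      (u := .inl ⟨i + l, by omega⟩) (v := .inl ⟨i + (l + 1), h⟩) (Or.inl ⟨_, rfl⟩)
      (Or.inl (Or.inl rfl)) (Or.inl (Or.inr rfl))
    exact (ih (by omega)).trans h1

theorem S1_low_lt (u : S1Vertex m d k) : S1Low u < d + 1 := by
  rcases u with i | ⟨i, l⟩ | ⟨t, l⟩ <;> simp only [S1Low] <;> omega

theorem S1_high_lt (u : S1Vertex m d k) : S1High u < d + 1 := by
  rcases u with i | ⟨i, l⟩ | ⟨t, l⟩ <;> simp only [S1High] <;> omega

theorem S1_walkLE_low (u : S1Vertex m d k) :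
    WalkLE (S1 m d k).cliqueGraph (S1Height u) u (.inl ⟨S1Low u, S1_low_lt u⟩) := by
  rcases u with i | ⟨i, l⟩ | ⟨t, l⟩
  · exact ⟨.nil, le_rfl⟩
  · exact walkLE_one (G := S1 m d k) (e := S1PathEdge m d k i) (Or.inl ⟨_, rfl⟩) (Or.inr ⟨l, rfl⟩)
      (Or.inl (Or.inl rfl))
  · exact walkLE_one (G := S1 m d k) (e := S1AttachedEdge m d k t) (Or.inr ⟨_, rfl⟩) (Or.inr ⟨l, rfl⟩)
      (Or.inl rfl)

theorem S1_walkLE_high (u : S1Vertex m d k) :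
    WalkLE (S1 m d k).cliqueGraph (S1Height u) u (.inl ⟨S1High u, S1_high_lt u⟩) := by
  rcases u with i | ⟨i, l⟩ | ⟨t, l⟩
  · exact ⟨.nil, le_rfl⟩
  · exact walkLE_one (G := S1 m d k) (e := S1PathEdge m d k i) (Or.inl ⟨_, rfl⟩) (Or.inr ⟨l, rfl⟩)
      (Or.inl (Or.inr rfl))
  · exact walkLE_one (G := S1 m d k) (e := S1AttachedEdge m d k t) (Or.inr ⟨_, rfl⟩) (Or.inr ⟨l, rfl⟩)
      (Or.inl rfl)

theorem S1_walkLE_of_le {u v : S1Vertex m d k} (h : S1High u ≤ S1Low v) :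
    WalkLE (S1 m d k).cliqueGraph (S1Height u + (S1Low v - S1High u) + S1Height v) u v := by
  have hv := S1_low_lt v
  have h1 := S1_walkLE_path (m := m) (d := d) (k := k) (S1High u) (S1Low v - S1High u) (by omega)
  have h2 : (⟨S1High u + (S1Low v - S1High u), by omega⟩ : Fin (d + 1)) = ⟨S1Low v, hv⟩ :=
    Fin.ext (by dsimp only; omega)
  rw [h2] at h1
  exact ((S1_walkLE_high u).trans h1).trans (S1_walkLE_low v).symm

theorem S1_walkLE (hd : 3 ≤ d) (u v : S1Vertex m d k) :
    WalkLE (S1 m d k).cliqueGraph d u v := by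
  have key : (∃ i, u ∈ S1PathEdge m d k i ∧ v ∈ S1PathEdge m d k i) ∨
      (S1High u ≤ S1Low v ∧ S1Height u + (S1Low v - S1High u) + S1Height v ≤ d) ∨
      (S1High v ≤ S1Low u ∧ S1Height v + (S1Low u - S1High v) + S1Height u ≤ d) := by
    -- Two vertices are joined by going to the path, along it, and away from it. This fails to cover
    -- only two new vertices of the same path edge, whose intervals of indices overlap; they are at
    -- distance at most one.
    rcases u with i | ⟨i, l⟩ | ⟨t, l⟩ <;> rcases v with i' | ⟨i', l'⟩ | ⟨t', l'⟩ <;>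
      simp only [S1High, S1Low, S1Height]
    on_goal 5 =>
      by_cases h : i = i'
      · subst h
        exact Or.inl ⟨i, Or.inr ⟨l, rfl⟩, Or.inr ⟨l', rfl⟩⟩
      · have : (i : ℕ) ≠ i' := fun h' => h (Fin.ext h')
        right
        omega
    all_goals right; omega
  rcases key with ⟨i, hu, hv⟩ | ⟨h, hle⟩ | ⟨h, hle⟩
  · exact (walkLE_one (Or.inl ⟨i, rfl⟩) hu hv).mono (by omega)
  · exact (S1_walkLE_of_le h).mono hle
  · exact ((S1_walkLE_of_le h).mono hle).symm

theorem S1_hasDiameter (hd : 3 ≤ d) : (S1 m d k).HasDiameter d := by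
  have hconn : (S1 m d k).cliqueGraph.Connected := by
    have : Nonempty (S1Vertex m d k) := ⟨.inl 0⟩
    refine ⟨fun u v => ?_⟩
    obtain ⟨p, -⟩ := S1_walkLE hd u v
    exact p.reachable
  have hpath := hasPath_dist (G := S1 m d k) rfl hconn
  have hle : ∀ u v, (S1 m d k).pathDist u v ≤ d := fun u v => by
    obtain ⟨p, hp⟩ := S1_walkLE hd u v
    exact (Nat.sInf_le (hpath u v)).trans ((SimpleGraph.dist_le p).trans hp)
  refine ⟨fun u _ v _ => ⟨_, hpath u v⟩, ⟨.inl 0, trivial, .inl (Fin.last d), trivial, ?_⟩, ?_⟩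
  · refine le_antisymm ?_ (hle _ _)
    have h1 := hasPath_pathDist ⟨_, hpath (.inl 0) (.inl (Fin.last d))⟩
    have h2 := h1.le_of_lipschitz S1Low_lipschitz
    simpa [S1Low] using h2
  · rintro _ ⟨u, -, v, -, rfl⟩
    exact hle u v

end Diameter

end Hypergraph

/-! ### Conclusion -/

namespace Hypergraph

/-- The reduced form has weight `c` determined by `c² (q - 1)ⁿ = 1`. -/
theorem exists_weight {q : ℝ} (hq : 2 ≤ q) (n : ℕ) :
    ∃ c : ℝ, 0 < c ∧ c ≤ 1 ∧ c ^ 2 * (q - 1) ^ n = 1 := by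
  have h1 : 1 ≤ (q - 1) ^ n := one_le_pow₀ (by linarith)
  have h0 : 0 < (q - 1) ^ n := by linarith
  refine ⟨√((q - 1) ^ n)⁻¹, Real.sqrt_pos.2 (inv_pos.2 h0), ?_, ?_⟩
  · exact Real.sqrt_le_one.2 (inv_le_one_of_one_le₀ h1)
  · rw [Real.sq_sqrt (inv_pos.2 h0).le, inv_mul_cancel₀ h0.ne']

theorem Isomorphic.signlessModuli_eq {α β ι J : Type*} [Finite α] [Finite β] [Finite J]
    {G : Hypergraph α} {H : Hypergraph β} {E : J → Finset ι} {k : ℕ}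
    (hcard : ∀ j, (E j).card = k - 1 + 1) (hH : H.Represents E) (h : G.Isomorphic H) :
    G.signlessModuli k = H.signlessModuli k := by
  classical
  have := Fintype.ofFinite J
  rw [(hH.of_isomorphic h).signlessModuli_eq hcard, hH.signlessModuli_eq hcard]

/-- A hypertree with `m` edges and diameter `d` whose spectral radius is at least that of
`S₁(m, d, k)` is isomorphic to it. -/
theorem isomorphic_S1_of_radius_le {m d k : ℕ} (hk : 3 ≤ k) (hd : 3 ≤ d) (hm : d + 1 ≤ m)
    {V W : Type*} [Finite V] [Fintype W] [DecidableEq W] {G : Hypergraph V} {T : SimpleGraph W}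
    (hT : T.IsTree) (hG : G.Represents (powerEdge (k - 2) (Subtype.val : T.edgeSet → Sym2 W)))
    (hcard : G.edgeSet.ncard = m) (hdiam : G.HasDiameter d)
    (hle : (S1 m d k).signlessRadius k ≤ G.signlessRadius k) : G.Isomorphic (S1 m d k) := by
  classical
  obtain ⟨hconn, ⟨u, hu, v, hv, huv⟩, -⟩ := hdiam
  have hpath := hasPath_pathDist (hconn u hu v hv)
  rw [← huv] at hpath
  obtain ⟨p, hp, hadj⟩ := exists_path_of_hasPath hT hG (by omega) hpath
  have : Nonempty W := hT.connected.nonempty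
  have : Nonempty T.edgeSet := ⟨⟨s(p 0, p 1), hadj 0 (by omega)⟩⟩
  have : Nonempty (Fin d ⊕ Fin (m - d)) := ⟨.inl ⟨0, by omega⟩⟩
  rw [hG.ncard_edgeSet, Nat.card_eq_fintype_card] at hcard
  obtain ⟨-, hq2, hlt, hmax⟩ :=
    hG.signlessRadius_spec hk fun e => T.not_isDiag_of_mem_edgeSet e.2
  obtain ⟨-, -, hlt', -⟩ :=
    (S1_represents m d hk).signlessRadius_spec hk (broomEdge_not_isDiag m d)
  -- The weight belongs to the radius of G and is used for both graphs, so that the two quadratic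
  -- forms can be compared.
  obtain ⟨c, hc0, hc1, hc⟩ := exists_weight hq2 (k - 2)
  obtain ⟨z, hz0, hz, heq⟩ := hmax c hc0 hc
  obtain ⟨α, β, hαβ⟩ := exists_equiv_broom hT hd hm hcard hp hadj (by linarith) hc0 hc1
    (fun z hz => by
      by_contra! h
      exact lt_irrefl _ (hlt _ c (by linarith) hc0 hc z hz (sub_pos.2 h))) hz0 hz heq
    (fun z hz => by
      by_contra! h
      exact hle.not_gt (hlt' _ c (by linarith) hc0 hc z hz (sub_pos.2 h)))
  refine (hG.reindex_powerEdge (by omega) α.symm β.symm fun e => ?_).isomorphic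
    (S1_represents m d hk)
  obtain ⟨j, rfl⟩ := β.surjective e
  rw [hαβ, β.symm_apply_apply, Sym2.map_map]
  simp

end Hypergraph

theorem theorem3p1 (m d k : ℕ) (hk : 3 ≤ k) (hd : 3 ≤ d) (hm : d + 1 ≤ m) :
    Hypergraph.S1 m d k ∈ Hypergraph.hypertrees (Hypergraph.S1Vertex m d k) m d k ∧
    IsGreatest (Hypergraph.signlessModuli k (Hypergraph.S1 m d k))
      (Hypergraph.signlessRadius k (Hypergraph.S1 m d k)) ∧
    ∀ (V : Type*) [Finite V] (G : Hypergraph V), G ∈ Hypergraph.hypertrees V m d k →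
      IsGreatest (Hypergraph.signlessModuli k G) (Hypergraph.signlessRadius k G) ∧
      Hypergraph.signlessRadius k G ≤ Hypergraph.signlessRadius k (Hypergraph.S1 m d k) ∧
      (Hypergraph.signlessRadius k G = Hypergraph.signlessRadius k (Hypergraph.S1 m d k) ↔
        G.Isomorphic (Hypergraph.S1 m d k)) := by
  classical
  have hS := Hypergraph.S1_represents m d hk
  have : Nonempty (Fin d ⊕ Fin (m - d)) := ⟨.inl ⟨0, by omega⟩⟩
  have hSmax := (hS.signlessRadius_spec hk (Hypergraph.broomEdge_not_isDiag m d)).1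
  have hScard : ∀ j, (Hypergraph.powerEdge (k - 2) (Hypergraph.broomEdge m d) j).card =
      k - 1 + 1 := fun j => by
    rw [Hypergraph.card_powerEdge (Hypergraph.broomEdge_not_isDiag m d)]
    omega
  refine ⟨⟨Hypergraph.S1_isHypertree hk (by omega), ?_, Hypergraph.S1_hasDiameter hd⟩, hSmax, ?_⟩
  · rw [hS.ncard_edgeSet]
    simp
    omega
  rintro V _ G ⟨⟨n, T, hT, hiso⟩, hcard, hdiam⟩
  have hG := (Hypergraph.graphPower_represents T hk).of_isomorphic hiso
  have hback : Hypergraph.signlessRadius k (Hypergraph.S1 m d k) ≤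
      Hypergraph.signlessRadius k G → G.Isomorphic (Hypergraph.S1 m d k) :=
    Hypergraph.isomorphic_S1_of_radius_le hk hd hm hT hG hcard hdiam
  have : Nonempty (Fin n) := hT.connected.nonempty
  have : Nonempty T.edgeSet := by
    rw [hG.ncard_edgeSet] at hcard
    have h0 : 0 < m := by omega
    rw [← hcard] at h0
    exact (Nat.card_pos_iff.1 h0).1
  have hGmax := (hG.signlessRadius_spec hk fun e => T.not_isDiag_of_mem_edgeSet e.2).1
  have hforth : G.Isomorphic (Hypergraph.S1 m d k) →
      Hypergraph.signlessRadius k G = Hypergraph.signlessRadius k (Hypergraph.S1 m d k) :=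
    fun h => hGmax.unique (h.signlessModuli_eq hScard hS ▸ hSmax)
  refine ⟨hGmax, ?_, fun h => hback h.ge, hforth⟩
  -- If q(G) exceeded q(S₁), then G would be isomorphic to S₁ and the two radii would be equal.
  by_contra! hlt
  exact hlt.ne' (hforth (hback hlt.le))
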